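/- Let $\beta>0$ and consider the critical long-range percolation on $\mathbb Z$ in which edges occur independently, every edge $\langle i,i+1\rangle$ is present, and for $|i-j|>1$ the edge $\langle i,j\rangle$ is present with probability $$1-\exp\Big\{-\beta\int_i^{i+1}\int_j^{j+1}\frac{1}{|u-v|^2}\,dv\,du\Big\}.$$ Write $u\sim v$ if $\langle u,v\rangle$ is an edge. A flow is a function $f$ on $\mathbb Z^2$ with $f_{ij}=-f_{ji}$ if $i\sim j$ and $f_{ij}=0$ otherwise. For disjoint $I_1,I_2\subset\mathbb Z$, a flow $f$ is a unit flow from $I_1$ to $I_2$ if its amount $\sum_{i\in I_1}\sum_{j\notin I_1}f_{ij}$ equals $1$ and $\sum_{k}f_{jk}=0$ for all $j\notin I_1\cup I_2$. For $n\ge1$ let $$\widehat R_n=\inf\Big\{\tfrac12\sum_{u\sim v}f_{uv}^2:\ f\text{ is a unit flow from }(-\infty,0]\text{ to }(2^n,\infty),\ f_{uv}=0\text{ for all edges }\langle u,v\rangle\text{ with }u\le 0,\ v>2^n\Big\},$$ where $\sum_{u\sim v}$ runs over ordered pairs of adjacent vertices, and for $\alpha\in(0,1)$ let $$a_{\alpha,n}=\sup\big\{r\ge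 0:\ \mathbb P[\widehat R_n\ge r]\ge 1-\alpha\big\}$$ be the $(1-\alpha)$-quantile of $\widehat R_n$. For any $\alpha\in(0,1/2]$, there exist constants $c=c(\alpha)>0$ and $\delta=\delta(\alpha)>0$, both depending only on $\beta$ and $\alpha$, such that $a_{\alpha,n}\ge c\,e^{\delta n}$ for all $n\ge 1$. -/

import Mathlib

open scoped NNReal ENNReal

namespace LRP

/-- The unordered pairs of distinct integers, each represented by its increasing ordering. -/
abbrev Pair : Type := {e : ℤ × ℤ // e.1 < e.2}

/-- The probability that the edge between `i < j` is present in the `β`-LRP model with `p₁ = 1`: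
nearest neighbours are always joined, and a long edge is present with probability
`1 - exp (-β ∫_i^{i+1} ∫_j^{j+1} |u - v|⁻² dv du)`. -/
noncomputable def edgeProb (β : ℝ≥0) (e : Pair) : unitInterval :=
  if e.1.2 = e.1.1 + 1 then 1
  else
    ⟨1 - Real.exp (-((β : ℝ) * ∫ u in (e.1.1 : ℝ)..(e.1.1 + 1 : ℝ),
        ∫ v in (e.1.2 : ℝ)..(e.1.2 + 1 : ℝ), 1 / |u - v| ^ 2)), by
      have h : 0 ≤ ∫ u in (e.1.1 : ℝ)..(e.1.1 + 1 : ℝ),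
          ∫ v in (e.1.2 : ℝ)..(e.1.2 + 1 : ℝ), 1 / |u - v| ^ 2 :=
        intervalIntegral.integral_nonneg (by linarith) fun u _ =>
          intervalIntegral.integral_nonneg (by linarith) fun v _ => by positivity
      constructor
      · have := Real.exp_le_one_iff.2 (neg_nonpos.2 (mul_nonneg β.2 h))
        simpa using this
      · have := Real.exp_pos (-((β : ℝ) * ∫ u in (e.1.1 : ℝ)..(e.1.1 + 1 : ℝ),
          ∫ v in (e.1.2 : ℝ)..(e.1.2 + 1 : ℝ), 1 / |u - v| ^ 2))
        linarith⟩

/-- The law of the `β`-LRP model on edge configurations: the states of the edges are independent,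
and each edge `e` is present (`true`) with probability `edgeProb β e`. -/
noncomputable def law (β : ℝ≥0) : MeasureTheory.Measure (Pair → Bool) :=
  MeasureTheory.Measure.infinitePi fun e =>
    ProbabilityTheory.bernoulliMeasure true false (edgeProb β e)

/-- The graph on `ℤ` described by an edge configuration. -/
def graph (ω : Pair → Bool) : SimpleGraph ℤ where
  Adj i j := (∃ h : i < j, ω ⟨(i, j), h⟩ = true) ∨ (∃ h : j < i, ω ⟨(j, i), h⟩ = true)
  symm := ⟨fun _ _ h => h.symm⟩
  loopless := ⟨fun _ h => h.elim (fun ⟨h, _⟩ => lt_irrefl _ h) (fun ⟨h, _⟩ => lt_irrefl _ h)⟩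

/-- A flow on `G`: an antisymmetric function supported on the (oriented) edges. -/
def IsFlow (G : SimpleGraph ℤ) (f : ℤ → ℤ → ℝ) : Prop :=
  (∀ i j, G.Adj i j → f i j = -f j i) ∧ ∀ i j, ¬ G.Adj i j → f i j = 0

/-- The net flow out of `i`. (Almost surely all vertices of the model have finite degree, so the
sum is a finite one.) -/
noncomputable def netFlow (f : ℤ → ℤ → ℝ) (i : ℤ) : ℝ := ∑' j, f i j

/-- The amount of a flow leaving the set `I`. -/
noncomputable def amount (f : ℤ → ℤ → ℝ) (I : Set ℤ) : ℝ := ∑' i : I, ∑' j : ↥Iᶜ, f i j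

/-- For a finite set `I` the amount of a flow leaving `I` is the sum of the net flows out of
the points of `I`. -/
theorem amount_eq_sum_netFlow {G : SimpleGraph ℤ} {f : ℤ → ℤ → ℝ} (hf : IsFlow G f)
    (I : Finset ℤ) (hs : ∀ i ∈ I, Summable (f i)) :
    amount f (I : Set ℤ) = ∑ i ∈ I, netFlow f i := by
  have anti : ∀ i j, f i j = -f j i := fun i j => by
    by_cases h : G.Adj i j
    · exact hf.1 i j h
    · rw [hf.2 i j h, hf.2 j i (fun h' => h h'.symm), neg_zero]
  have h0 : ∑ i ∈ I, ∑ j ∈ I, f i j = 0 := by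
    have h : ∑ i ∈ I, ∑ j ∈ I, f i j = -∑ i ∈ I, ∑ j ∈ I, f i j := by
      conv_lhs => rw [Finset.sum_comm]
      rw [← Finset.sum_neg_distrib]
      refine Finset.sum_congr rfl fun i _ => ?_
      rw [← Finset.sum_neg_distrib]
      exact Finset.sum_congr rfl fun j _ => anti j i
    linarith
  have h1 : amount f (I : Set ℤ) = ∑ i ∈ I, ∑' j : ↥((I : Set ℤ)ᶜ), f i j :=
    Finset.tsum_subtype I (fun i => ∑' j : ↥((I : Set ℤ)ᶜ), f i j)
  rw [h1, ← zero_add (∑ i ∈ I, ∑' j : ↥((I : Set ℤ)ᶜ), f i j), ← h0, ← Finset.sum_add_distrib]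
  exact Finset.sum_congr rfl fun i hi => (hs i hi).sum_add_tsum_compl

/-- `f` is a unit flow from `I₁` to `I₂` on `G`: a flow with amount one leaving `I₁` and with zero
net flow out of every point outside `I₁ ∪ I₂`. The sets may be infinite; for finite `I₁` the middle
condition says that the net flows out of the points of `I₁` sum to one
(`amount_eq_sum_netFlow`). -/
def IsUnitFlow (G : SimpleGraph ℤ) (I₁ I₂ : Set ℤ) (f : ℤ → ℤ → ℝ) : Prop :=
  IsFlow G f ∧ amount f I₁ = 1 ∧ ∀ j, j ∉ I₁ ∪ I₂ → netFlow f j = 0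

/-- The energy `½ ∑_{u ∼ v} f_{uv}²`, the sum being over ordered pairs of adjacent vertices, with
values in `[0, ∞]`. -/
noncomputable def energy (G : SimpleGraph ℤ) (f : ℤ → ℤ → ℝ) : ℝ≥0∞ :=
  (1 / 2) * ∑' p : {p : ℤ × ℤ // G.Adj p.1 p.2}, ENNReal.ofReal (f p.1.1 p.1.2 ^ 2)

/-- The effective resistance generated by the unit flows from `(-∞, 0]` to `(2ⁿ, ∞)` that
pass through `(0, 2ⁿ]`, that is, do not use the edges between `(-∞, 0]` and `(2ⁿ, ∞)`. -/
noncomputable def Rhat (G : SimpleGraph ℤ) (n : ℕ) : ℝ≥0∞ :=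
  ⨅ (f : ℤ → ℤ → ℝ) (_ : IsUnitFlow G (Set.Iic 0) (Set.Ioi (2 ^ n)) f ∧
    ∀ u v, u ∈ Set.Iic (0 : ℤ) → v ∈ Set.Ioi ((2 : ℤ) ^ n) → G.Adj u v → f u v = 0), energy G f

/-- The `(1 - α)`-quantile `sup {r ≥ 0 : P[Rhat_n ≥ r] ≥ 1 - α}` of `Rhat_n` in the `β`-LRP
model. (As `Rhat_n ≤ 2ⁿ + 1`, the set is bounded for `α < 1`.) -/
noncomputable def quantile (β : ℝ≥0) (α : ℝ) (n : ℕ) : ℝ :=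
  sSup {r : ℝ | 0 ≤ r ∧
    ENNReal.ofReal (1 - α) ≤ law β {ω | ENNReal.ofReal r ≤ Rhat (graph ω) n}}

end LRP

/-! The proof replaces `Rhat` by a resistance attached to a block `(a, b]`: `Crossing` tests
finitely supported flows on the edges incident to the block, conserved inside it and unconstrained
outside. This quantity depends only on the incident edges, can only grow when edges are deleted, and
is comparable across scales. `Robust` asks for it with failure probability at most `α`, uniformly in
the position of the block. The aim is to show that it doubles whenever the scale grows by a fixed
factor, with no loss in `α`.

Deterministic doubling (`crossing_two_mul`): place sixteen disjoint sub-blocks of resistance `r` in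
the block. Every cut carries the same flux `θ`. If each sub-block is crossed by at least `θ / 2`,
the energies add up to `2 r θ²`, since an edge touches at most two sub-blocks. Otherwise at least
half of the flux jumps over some sub-block. If at most `W` long edges exist, one of them carries at
least `θ / (2 W)`, and this flow must traverse every isolated annulus around an endpoint of that
edge. An annulus consists of two blocks of resistance `r`, so `Q ≥ 32 W²` disjoint annuli again cost
`2 r θ²`.

Probability (`robust_two_mul`): a decreasing event may be tested after deleting all edges outside a
chosen set, which only makes it likelier, and tests on disjoint edge sets are independent. At
criticality the estimates are scale invariant: the expected number of edges of length at least `ℓ`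
touching a block of length `N` is at most a constant times `N / ℓ`, and an annulus is free of local
shortcuts with probability at least `exp (-64 β)` at every scale. For `α` below a multiple of this
constant, an annulus is good with probability bounded below, and many separated scales supply as
many good annuli as needed. All parameters depend only on `β` and `α`, so induction over dyadic
scales gives exponential growth (`exists_robust_pow`). `ofReal_le_Rhat` and `le_quantile` transfer
it to the quantile, and larger `α` are covered by monotonicity. -/

namespace LRP

/-! ### Deterministic estimates for flows through a block. -/

open Set

/-- The total of `f` over the pairs in `X × Y` of the window `V`. -/
noncomputable def flux (V : Finset ℤ) (f : ℤ → ℤ → ℝ) (X Y : Set ℤ) : ℝ := by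
  classical exact ∑ p ∈ V ×ˢ V, if p.1 ∈ X ∧ p.2 ∈ Y then f p.1 p.2 else 0

/-- The energy of `f` on the window `V`. -/
noncomputable def windowEnergy (V : Finset ℤ) (f : ℤ → ℤ → ℝ) : ℝ :=
  1 / 2 * ∑ p ∈ V ×ˢ V, f p.1 p.2 ^ 2

/-- A finitely supported flow on the edges incident to the block `(a, b]`, conserved on it. -/
structure IsThroughFlow (ω : Pair → Bool) (V : Finset ℤ) (a b : ℤ) (f : ℤ → ℤ → ℝ) : Prop where
  antisymm : ∀ u v, f u v = -f v u
  support : ∀ u v, f u v ≠ 0 →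
    u ∈ V ∧ (graph ω).Adj u v ∧ (u ∈ Ioc a b ∨ v ∈ Ioc a b)
  conserved : ∀ u ∈ Ioc a b, ∑ v ∈ V, f u v = 0

/-- Every flow through the block `(a, b]` with flux `θ` has energy at least `r θ²`. -/
def Crossing (ω : Pair → Bool) (a b : ℤ) (r : ℝ) : Prop :=
  ∀ (V : Finset ℤ) (f : ℤ → ℤ → ℝ), IsThroughFlow ω V a b f →
    r * flux V f (Iic a) (Ioc a b) ^ 2 ≤ windowEnergy V f

theorem Crossing.mono {ω : Pair → Bool} {a b : ℤ} {r r' : ℝ} (h : Crossing ω a b r)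
    (hr : r' ≤ r) : Crossing ω a b r' := fun V f hf =>
  (mul_le_mul_of_nonneg_right hr (sq_nonneg _)).trans (h V f hf)

theorem Crossing.of_adj {ω ω' : Pair → Bool} {a b : ℤ} {r : ℝ} (h : Crossing ω' a b r)
    (hadj : ∀ u ∈ Ioc a b, ∀ v, (graph ω).Adj u v → (graph ω').Adj u v) : Crossing ω a b r := by
  refine fun V f hf => h V f ⟨hf.antisymm, fun u v huv => ?_, hf.conserved⟩
  obtain ⟨hu, hadj', hI⟩ := hf.support u v huv
  refine ⟨hu, ?_, hI⟩
  rcases hI with hI | hI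
  · exact hadj u hI v hadj'
  · exact (hadj v hI u hadj'.symm).symm

variable {ω : Pair → Bool} {V : Finset ℤ} {a b : ℤ} {f : ℤ → ℤ → ℝ}

theorem flux_swap (hf : ∀ u v, f u v = -f v u) (X Y : Set ℤ) : flux V f X Y = -flux V f Y X := by
  classical
  unfold flux
  rw [Finset.sum_product, Finset.sum_product_right, ← Finset.sum_neg_distrib]
  refine Finset.sum_congr rfl fun u _ => ?_
  rw [← Finset.sum_neg_distrib]
  refine Finset.sum_congr rfl fun v _ => ?_
  have := hf u v
  by_cases h : u ∈ X ∧ v ∈ Y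
  · rw [if_pos h, if_pos h.symm, this]
  · rw [if_neg h, if_neg fun h' => h h'.symm, neg_zero]

theorem flux_self (hf : ∀ u v, f u v = -f v u) (X : Set ℤ) : flux V f X X = 0 := by
  have := flux_swap (V := V) hf X X
  linarith

theorem flux_univ_eq_zero {X : Set ℤ} (h : ∀ u ∈ X, ∑ v ∈ V, f u v = 0) :
    flux V f X univ = 0 := by
  classical
  unfold flux
  rw [Finset.sum_product]
  refine Finset.sum_eq_zero fun u _ => ?_
  by_cases hu : u ∈ X
  · simpa [hu] using h u hu
  · simp [hu]

theorem flux_add_compl (X Y : Set ℤ) : flux V f X Y + flux V f X Yᶜ = flux V f X univ := by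
  classical
  unfold flux
  rw [← Finset.sum_add_distrib]
  refine Finset.sum_congr rfl fun p _ => ?_
  by_cases h1 : p.1 ∈ X <;> by_cases h2 : p.2 ∈ Y <;> simp [h1, h2]

/-- Kirchhoff's law for a set: the internal flux cancels by antisymmetry. -/
theorem flux_compl_eq_zero (hf : ∀ u v, f u v = -f v u) {X : Set ℤ}
    (h : ∀ u ∈ X, ∑ v ∈ V, f u v = 0) : flux V f X Xᶜ = 0 := by
  have h1 := flux_add_compl (V := V) (f := f) X X
  rw [flux_self hf, flux_univ_eq_zero h] at h1
  linarith

theorem flux_congr {X Y X' Y' : Set ℤ} (h : ∀ u v, f u v ≠ 0 → (u ∈ X ∧ v ∈ Y ↔ u ∈ X' ∧ v ∈ Y')) :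
    flux V f X Y = flux V f X' Y' := by
  classical
  unfold flux
  refine Finset.sum_congr rfl fun p _ => ?_
  by_cases h0 : f p.1 p.2 = 0
  · simp [h0]
  · simp only [h _ _ h0]

/-- The flux splits over disjoint unions. -/
theorem flux_split {X Y X₁ Y₁ X₂ Y₂ : Set ℤ}
    (h : ∀ u v, f u v ≠ 0 → (u ∈ X ∧ v ∈ Y ↔ (u ∈ X₁ ∧ v ∈ Y₁) ∨ (u ∈ X₂ ∧ v ∈ Y₂)))
    (hd : ∀ u v, f u v ≠ 0 → ¬ ((u ∈ X₁ ∧ v ∈ Y₁) ∧ (u ∈ X₂ ∧ v ∈ Y₂))) :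
    flux V f X Y = flux V f X₁ Y₁ + flux V f X₂ Y₂ := by
  classical
  unfold flux
  rw [← Finset.sum_add_distrib]
  refine Finset.sum_congr rfl fun p _ => ?_
  by_cases h0 : f p.1 p.2 = 0
  · simp [h0]
  · have h1 := h _ _ h0
    have h2 := hd _ _ h0
    by_cases hA : p.1 ∈ X₁ ∧ p.2 ∈ Y₁
    · have hB : ¬ (p.1 ∈ X₂ ∧ p.2 ∈ Y₂) := fun hB => h2 ⟨hA, hB⟩
      rw [if_pos hA, if_neg hB, if_pos (h1.2 (Or.inl hA)), add_zero]
    · by_cases hB : p.1 ∈ X₂ ∧ p.2 ∈ Y₂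
      · rw [if_neg hA, if_pos hB, if_pos (h1.2 (Or.inr hB)), zero_add]
      · rw [if_neg hA, if_neg hB, if_neg, zero_add]
        rw [h1]; tauto

theorem flux_singleton {x y : ℤ} (hx : x ∈ V) (hy : y ∈ V) : flux V f {x} {y} = f x y := by
  classical
  unfold flux
  rw [Finset.sum_eq_single (x, y)]
  · simp
  · rintro ⟨u, v⟩ _ h
    rw [if_neg]
    rintro ⟨h1, h2⟩
    simp_all
  · intro h
    exact absurd (Finset.mk_mem_product hx hy) h

namespace IsThroughFlow

theorem mem_right (hf : IsThroughFlow ω V a b f) {u v : ℤ} (h : f u v ≠ 0) : v ∈ V :=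
  (hf.support v u (by rw [hf.antisymm v u]; simpa using h)).1

/-- The restriction of a flow to the edges incident to a smaller block. -/
theorem restrict (hf : IsThroughFlow ω V a b f) {c d : ℤ} (h : Ioc c d ⊆ Ioc a b) :
    IsThroughFlow ω V c d (fun u v => by
      classical exact if u ∈ Ioc c d ∨ v ∈ Ioc c d then f u v else 0) := by
  classical
  refine ⟨fun u v => ?_, fun u v huv => ?_, fun u hu => ?_⟩
  · by_cases h : u ∈ Ioc c d ∨ v ∈ Ioc c d
    · simp only [if_pos h, if_pos h.symm, hf.antisymm u v]
    · simp only [if_neg h, if_neg (fun h' => h (Or.symm h')), neg_zero]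
  · by_cases h' : u ∈ Ioc c d ∨ v ∈ Ioc c d
    · simp only [if_pos h'] at huv
      exact ⟨(hf.support u v huv).1, (hf.support u v huv).2.1, h'⟩
    · simp only [if_neg h', ne_eq, not_true] at huv
  · rw [← hf.conserved u (h hu)]
    refine Finset.sum_congr rfl fun v _ => ?_
    rw [if_pos (Or.inl hu)]

/-- Restrict the flow to the edges touching each sub-block and add the energies. As the sub-blocks
are disjoint, each edge is counted at most once per endpoint, whence the factor two. -/
theorem two_mul_energy_ge (hf : IsThroughFlow ω V a b f) {ι : Type*} (s : Finset ι)
    (c d : ι → ℤ) (hsub : ∀ i ∈ s, Ioc (c i) (d i) ⊆ Ioc a b)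
    (hdisj : ∀ i ∈ s, ∀ j ∈ s, ∀ u, u ∈ Ioc (c i) (d i) → u ∈ Ioc (c j) (d j) → i = j)
    {r : ℝ} (hr : ∀ i ∈ s, Crossing ω (c i) (d i) r) :
    r * ∑ i ∈ s, flux V f (Iic (c i)) (Ioc (c i) (d i)) ^ 2 ≤ 2 * windowEnergy V f := by
  classical
  have hone : ∀ u, ∑ i ∈ s, (if u ∈ Ioc (c i) (d i) then (1 : ℝ) else 0) ≤ 1 := by
    intro u
    rw [Finset.sum_ite, Finset.sum_const_zero, add_zero, Finset.sum_const, nsmul_eq_mul, mul_one]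
    have : (s.filter fun i => u ∈ Ioc (c i) (d i)).card ≤ 1 := by
      rw [Finset.card_le_one]
      intro i hi j hj
      rw [Finset.mem_filter] at hi hj
      exact hdisj i hi.1 j hj.1 u hi.2 hj.2
    exact_mod_cast this
  have h1 : ∀ i ∈ s, r * flux V f (Iic (c i)) (Ioc (c i) (d i)) ^ 2 ≤
      1 / 2 * ∑ p ∈ V ×ˢ V, ((if p.1 ∈ Ioc (c i) (d i) then (1 : ℝ) else 0) +
        (if p.2 ∈ Ioc (c i) (d i) then (1 : ℝ) else 0)) * f p.1 p.2 ^ 2 := by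
    intro i hi
    have h2 := hr i hi V _ (hf.restrict (hsub i hi))
    have h3 : flux V (fun u v => if u ∈ Ioc (c i) (d i) ∨ v ∈ Ioc (c i) (d i) then f u v else 0)
        (Iic (c i)) (Ioc (c i) (d i)) = flux V f (Iic (c i)) (Ioc (c i) (d i)) := by
      unfold flux
      refine Finset.sum_congr rfl fun p _ => ?_
      by_cases hp : p.1 ∈ Iic (c i) ∧ p.2 ∈ Ioc (c i) (d i)
      · rw [if_pos hp, if_pos hp]
        exact if_pos (Or.inr hp.2)
      · rw [if_neg hp, if_neg hp]
    rw [h3] at h2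
    refine h2.trans (mul_le_mul_of_nonneg_left (Finset.sum_le_sum fun p _ => ?_) (by norm_num))
    have := sq_nonneg (f p.1 p.2)
    by_cases hp : p.1 ∈ Ioc (c i) (d i) <;> by_cases hq : p.2 ∈ Ioc (c i) (d i) <;>
      simp [hp, hq]
    linarith
  rw [Finset.mul_sum]
  refine (Finset.sum_le_sum h1).trans ?_
  rw [← Finset.mul_sum, Finset.sum_comm]
  have h4 : ∑ p ∈ V ×ˢ V, ∑ i ∈ s, ((if p.1 ∈ Ioc (c i) (d i) then (1 : ℝ) else 0) +
        (if p.2 ∈ Ioc (c i) (d i) then (1 : ℝ) else 0)) * f p.1 p.2 ^ 2 ≤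
      ∑ p ∈ V ×ˢ V, 2 * f p.1 p.2 ^ 2 := by
    refine Finset.sum_le_sum fun p _ => ?_
    rw [← Finset.sum_mul, Finset.sum_add_distrib]
    exact mul_le_mul_of_nonneg_right (by linarith [hone p.1, hone p.2]) (sq_nonneg _)
  rw [← Finset.mul_sum] at h4
  unfold windowEnergy
  linarith

/-- The flux across every cut of the block is the same. -/
theorem flux_cut (hf : IsThroughFlow ω V a b f) {z : ℤ} (haz : a ≤ z) (hzb : z ≤ b) :
    flux V f (Iic z) (Ioi z) = flux V f (Iic a) (Ioc a b) := by
  have h1 : flux V f (Iic a) (Ioc a b) = flux V f (Iic a) (Ioi a) := by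
    refine flux_congr fun u v h => ?_
    have := (hf.support u v h).2.2
    simp only [mem_Ioc, mem_Iic, mem_Ioi] at *
    omega
  -- Moving the cut from `a` to `z` changes the flux by the net flux out of `(a, z]`, which is
  -- conserved.
  have h2 : flux V f (Ioc a z) (Ioc a z)ᶜ = 0 :=
    flux_compl_eq_zero hf.antisymm fun u hu => hf.conserved u ⟨hu.1, hu.2.trans hzb⟩
  have h3 : flux V f (Ioc a z) (Ioc a z)ᶜ =
      flux V f (Ioc a z) (Ioi z) + flux V f (Ioc a z) (Iic a) := by
    refine flux_split (fun u v _ => ?_) (fun u v _ => ?_) <;>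
    simp only [mem_Ioc, mem_Iic, mem_Ioi, mem_compl_iff] <;> omega
  have h4 : flux V f (Iic z) (Ioi z) = flux V f (Iic a) (Ioi z) + flux V f (Ioc a z) (Ioi z) := by
    refine flux_split (fun u v _ => ?_) (fun u v _ => ?_) <;>
    simp only [mem_Ioc, mem_Iic, mem_Ioi] <;> omega
  have h5 : flux V f (Iic a) (Ioi a) = flux V f (Iic a) (Ioi z) + flux V f (Iic a) (Ioc a z) := by
    refine flux_split (fun u v _ => ?_) (fun u v _ => ?_) <;>
    simp only [mem_Ioc, mem_Iic, mem_Ioi] <;> omega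
  have h6 := flux_swap (V := V) hf.antisymm (Ioc a z) (Iic a)
  rw [h1]
  linarith

theorem flux_block_add_jump (hf : IsThroughFlow ω V a b f) {c d : ℤ} (hac : a ≤ c) (hcd : c ≤ d)
    (hdb : d ≤ b) : flux V f (Iic c) (Ioc c d) + flux V f (Iic c) (Ioi d) =
      flux V f (Iic a) (Ioc a b) := by
  rw [← hf.flux_cut hac (hcd.trans hdb)]
  symm
  refine flux_split (fun u v _ => ?_) (fun u v _ => ?_) <;>
    simp only [mem_Ioc, mem_Iic, mem_Ioi] <;> omega

/-- If at most `W` edges jump over the sub-block, then one of them carries a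
proportion `1 / W` of their total flux. -/
theorem exists_jump (hf : IsThroughFlow ω V a b f) {c d : ℤ} (hcd : c ≤ d) {W : ℕ}
    (T : Finset Pair) (hT : T.card ≤ W)
    (hmem : ∀ e : Pair, ω e = true → e.1.1 ≤ c → d < e.1.2 →
      (e.1.1 ∈ Ioc a b ∨ e.1.2 ∈ Ioc a b) → e ∈ T)
    (h0 : flux V f (Iic c) (Ioi d) ≠ 0) :
    ∃ u v, u ≤ c ∧ d < v ∧ f u v ≠ 0 ∧ |flux V f (Iic c) (Ioi d)| ≤ W * |f u v| := by
  classical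
  set S := (V ×ˢ V).filter fun p => f p.1 p.2 ≠ 0 ∧ p.1 ≤ c ∧ d < p.2 with hS
  have hcard : S.card ≤ W := by
    refine le_trans ?_ hT
    refine Finset.card_le_card_of_injOn
      (fun p => if h : p.1 < p.2 then (⟨p, h⟩ : Pair) else ⟨(0, 1), zero_lt_one⟩) ?_ ?_
    · intro p hp
      obtain ⟨-, h1, h2, h3⟩ := Finset.mem_filter.1 hp
      have hlt : p.1 < p.2 := by omega
      obtain ⟨-, h4, h5⟩ := hf.support _ _ h1
      simp only [dif_pos hlt]
      refine hmem _ ?_ h2 h3 h5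
      rcases h4 with ⟨_, h⟩ | ⟨h, _⟩
      · exact h
      · omega
    · intro p hp q hq hpq
      obtain ⟨-, h1, h2, h3⟩ := Finset.mem_filter.1 hp
      obtain ⟨-, h1', h2', h3'⟩ := Finset.mem_filter.1 hq
      have hlt : p.1 < p.2 := by omega
      have hlt' : q.1 < q.2 := by omega
      simp only [dif_pos hlt, dif_pos hlt'] at hpq
      exact congrArg Subtype.val hpq
  have hflux : flux V f (Iic c) (Ioi d) = ∑ p ∈ S, f p.1 p.2 := by
    unfold flux
    rw [hS, Finset.sum_filter]
    refine Finset.sum_congr rfl fun p _ => ?_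
    by_cases h : f p.1 p.2 = 0
    · simp [h]
    · simp [h]
  have hne : S.Nonempty := by
    rw [Finset.nonempty_iff_ne_empty]
    intro h
    rw [hflux, h] at h0
    simp at h0
  obtain ⟨p, hp, hmax⟩ := Finset.exists_max_image S (fun p => |f p.1 p.2|) hne
  obtain ⟨-, h1, h2, h3⟩ := Finset.mem_filter.1 hp
  refine ⟨p.1, p.2, h2, h3, h1, ?_⟩
  rw [hflux]
  calc |∑ p ∈ S, f p.1 p.2| ≤ ∑ q ∈ S, |f q.1 q.2| := Finset.abs_sum_le_sum_abs _ _
    _ ≤ ∑ q ∈ S, |f p.1 p.2| := Finset.sum_le_sum hmax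
    _ = S.card * |f p.1 p.2| := by simp
    _ ≤ W * |f p.1 p.2| := by
      gcongr

/-- Cauchy–Schwarz over the edges that enter the block from the left. -/
theorem flux_sq_le (hf : IsThroughFlow ω V a b f) {W : ℕ} (T : Finset Pair) (hT : T.card ≤ W)
    (hmem : ∀ e : Pair, ω e = true → (e.1.1 ∈ Ioc a b ∨ e.1.2 ∈ Ioc a b) → e ∈ T) :
    flux V f (Iic a) (Ioc a b) ^ 2 ≤ W * (2 * windowEnergy V f) := by
  classical
  set S := (V ×ˢ V).filter fun p => f p.1 p.2 ≠ 0 ∧ p.1 ≤ a ∧ p.2 ∈ Ioc a b with hS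
  have hcard : S.card ≤ W := by
    refine le_trans ?_ hT
    refine Finset.card_le_card_of_injOn
      (fun p => if h : p.1 < p.2 then (⟨p, h⟩ : Pair) else ⟨(0, 1), zero_lt_one⟩) ?_ ?_
    · intro p hp
      obtain ⟨-, h1, h2, h3⟩ := Finset.mem_filter.1 hp
      have hlt : p.1 < p.2 := lt_of_le_of_lt h2 h3.1
      obtain ⟨-, h4, h5⟩ := hf.support _ _ h1
      simp only [dif_pos hlt]
      refine hmem _ ?_ h5
      rcases h4 with ⟨_, h⟩ | ⟨h, _⟩
      · exact h
      · omega
    · intro p hp q hq hpq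
      obtain ⟨-, h1, h2, h3⟩ := Finset.mem_filter.1 hp
      obtain ⟨-, h1', h2', h3'⟩ := Finset.mem_filter.1 hq
      have hlt : p.1 < p.2 := lt_of_le_of_lt h2 h3.1
      have hlt' : q.1 < q.2 := lt_of_le_of_lt h2' h3'.1
      simp only [dif_pos hlt, dif_pos hlt'] at hpq
      exact congrArg Subtype.val hpq
  have hflux : flux V f (Iic a) (Ioc a b) = ∑ p ∈ S, f p.1 p.2 := by
    unfold flux
    rw [hS, Finset.sum_filter]
    refine Finset.sum_congr rfl fun p _ => ?_
    by_cases h : f p.1 p.2 = 0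
    · simp [h]
    · simp [h]
  have hle : ∑ p ∈ S, f p.1 p.2 ^ 2 ≤ 2 * windowEnergy V f := by
    have := Finset.sum_le_sum_of_subset_of_nonneg (f := fun p : ℤ × ℤ => f p.1 p.2 ^ 2)
      (Finset.filter_subset (fun p => f p.1 p.2 ≠ 0 ∧ p.1 ≤ a ∧ p.2 ∈ Ioc a b) (V ×ˢ V))
      fun _ _ _ => sq_nonneg _
    unfold windowEnergy
    linarith
  rw [hflux]
  calc (∑ p ∈ S, f p.1 p.2) ^ 2 ≤ S.card * ∑ p ∈ S, f p.1 p.2 ^ 2 := sq_sum_le_card_mul_sum_sq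
    _ ≤ W * ∑ p ∈ S, f p.1 p.2 ^ 2 := by
      gcongr
    _ ≤ W * (2 * windowEnergy V f) := by gcongr

/-- If the edge `{x, y}` is the only one leaving the neighbourhood of `x` other than into the two
adjacent blocks, then its flow crosses these blocks. -/
theorem annulus (hf : IsThroughFlow ω V a b f) {x y ρ : ℤ} (hρ : 0 < ρ)
    (hxa : a ≤ x - 2 * ρ) (hxb : x + 2 * ρ ≤ b) (hy : y ∉ Ioc (x - 2 * ρ) (x + 2 * ρ))
    (hB : ∀ u ∈ Ioc (x - ρ) (x + ρ), ∀ v ∉ Ioc (x - 2 * ρ) (x + 2 * ρ),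
      (graph ω).Adj u v → u = x ∧ v = y)
    (hL : ∀ u ∈ Ioc (x - 2 * ρ) (x - ρ), ∀ v, x + ρ < v → ¬ (graph ω).Adj u v)
    (hR : ∀ u ∈ Ioc (x + ρ) (x + 2 * ρ), ∀ v, v ≤ x - ρ → ¬ (graph ω).Adj u v) :
    f x y ^ 2 ≤ 2 * (flux V f (Iic (x - 2 * ρ)) (Ioc (x - 2 * ρ) (x - ρ)) ^ 2 +
      flux V f (Iic (x + ρ)) (Ioc (x + ρ) (x + 2 * ρ)) ^ 2) := by
  by_cases hxy : f x y = 0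
  · rw [hxy, zero_pow two_ne_zero]; positivity
  have hxV : x ∈ V := (hf.support x y hxy).1
  have hyV : y ∈ V := hf.mem_right hxy
  have hcons : flux V f (Ioc (x - ρ) (x + ρ)) (Ioc (x - ρ) (x + ρ))ᶜ = 0 :=
    flux_compl_eq_zero hf.antisymm fun u hu => hf.conserved u
      ⟨by have := hu.1; omega, by have := hu.2; omega⟩
  have h1 : flux V f (Ioc (x - ρ) (x + ρ)) (Ioc (x - ρ) (x + ρ))ᶜ =
      flux V f (Ioc (x - ρ) (x + ρ)) (Ioc (x - 2 * ρ) (x + 2 * ρ) \ Ioc (x - ρ) (x + ρ)) +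
        flux V f {x} {y} := by
    refine flux_split (fun u v h => ?_) (fun u v _ => ?_)
    · have h2 := hB u
      have h3 := (hf.support u v h).2.1
      constructor
      · rintro ⟨hu, hv⟩
        by_cases hv' : v ∈ Ioc (x - 2 * ρ) (x + 2 * ρ)
        · exact Or.inl ⟨hu, hv', hv⟩
        · exact Or.inr (h2 hu v hv' h3)
      · rintro (⟨hu, hv⟩ | ⟨hu, hv⟩)
        · exact ⟨hu, hv.2⟩
        · rw [mem_singleton_iff] at hu hv
          subst hu hv
          simp only [mem_Ioc, mem_compl_iff] at *
          omega
    · rintro ⟨⟨-, h2⟩, -, h3⟩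
      rw [mem_singleton_iff] at h3
      subst h3
      exact hy h2.1
  have h2 : flux V f (Ioc (x - ρ) (x + ρ)) (Ioc (x - 2 * ρ) (x + 2 * ρ) \ Ioc (x - ρ) (x + ρ)) =
      flux V f (Ioc (x - ρ) (x + ρ)) (Ioc (x - 2 * ρ) (x - ρ)) +
      flux V f (Ioc (x - ρ) (x + ρ)) (Ioc (x + ρ) (x + 2 * ρ)) := by
    refine flux_split (fun u v _ => ?_) (fun u v _ => ?_) <;>
    simp only [mem_Ioc, mem_sdiff] <;> omega
  have h3 : flux V f (Ioc (x - ρ) (x + ρ)) (Ioc (x + ρ) (x + 2 * ρ)) =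
      flux V f (Iic (x + ρ)) (Ioc (x + ρ) (x + 2 * ρ)) := by
    refine flux_congr fun u v h => ?_
    have h4 := hR v
    have h5 := (hf.support u v h).2.1
    constructor
    · rintro ⟨hu, hv⟩
      exact ⟨hu.2, hv⟩
    · rintro ⟨hu, hv⟩
      refine ⟨⟨?_, hu⟩, hv⟩
      by_contra hlt
      exact h4 hv u (by omega) h5.symm
  have h4 : flux V f (Ioc (x - 2 * ρ) (x - ρ)) (Ioc (x - ρ) (x + ρ)) =
      flux V f (Ioc (x - 2 * ρ) (x - ρ)) (Ioi (x - ρ)) := by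
    refine flux_congr fun u v h => ?_
    have h4 := hL u
    have h5 := (hf.support u v h).2.1
    constructor
    · rintro ⟨hu, hv⟩
      exact ⟨hu, hv.1⟩
    · rintro ⟨hu, hv⟩
      refine ⟨hu, hv, ?_⟩
      by_contra hlt
      exact h4 hu v (by omega) h5
  have h5 : flux V f (Ioc (x - 2 * ρ) (x - ρ)) (Ioc (x - 2 * ρ) (x - ρ))ᶜ = 0 :=
    flux_compl_eq_zero hf.antisymm fun u hu => hf.conserved u
      ⟨by have := hu.1; omega, by have := hu.2; omega⟩
  have h6 : flux V f (Ioc (x - 2 * ρ) (x - ρ)) (Ioc (x - 2 * ρ) (x - ρ))ᶜ =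
      flux V f (Ioc (x - 2 * ρ) (x - ρ)) (Ioi (x - ρ)) +
      flux V f (Ioc (x - 2 * ρ) (x - ρ)) (Iic (x - 2 * ρ)) := by
    refine flux_split (fun u v _ => ?_) (fun u v _ => ?_) <;>
    simp only [mem_Ioc, mem_compl_iff, mem_Ioi, mem_Iic] <;> omega
  have h7 := flux_swap (V := V) hf.antisymm (Ioc (x - 2 * ρ) (x - ρ)) (Iic (x - 2 * ρ))
  have h8 := flux_swap (V := V) hf.antisymm (Ioc (x - 2 * ρ) (x - ρ)) (Ioc (x - ρ) (x + ρ))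
  have h9 := flux_singleton (f := f) hxV hyV
  set A := flux V f (Iic (x - 2 * ρ)) (Ioc (x - 2 * ρ) (x - ρ))
  set B := flux V f (Iic (x + ρ)) (Ioc (x + ρ) (x + 2 * ρ))
  -- Conservation on the inner ball: `A` enters it through the left block, `B` leaves it through the
  -- right block, and the rest can only use `{x, y}`. Then `(A - B)² ≤ 2 (A² + B²)`.
  have h10 : f x y = A - B := by linarith
  rw [h10]
  nlinarith [sq_nonneg (A + B)]

end IsThroughFlow

/-- A block with at most `W` incident edges has crossing resistance at least `1 / (2 W)`. -/
theorem crossing_of_card_le {W : ℕ} (hW : 0 < W) (T : Finset Pair) (hT : T.card ≤ W)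
    (hmem : ∀ e : Pair, ω e = true → (e.1.1 ∈ Ioc a b ∨ e.1.2 ∈ Ioc a b) → e ∈ T) :
    Crossing ω a b (1 / (2 * W)) := by
  intro V f hf
  have h := hf.flux_sq_le T hT hmem
  have hW' : (0 : ℝ) < W := by exact_mod_cast hW
  rw [one_div, inv_mul_le_iff₀ (by positivity)]
  linarith

end LRP

namespace LRP

open MeasureTheory ProbabilityTheory Set

/-! ### Edge probabilities -/

/-- The length of an edge. -/
def len (e : Pair) : ℤ := e.1.2 - e.1.1

theorem len_pos (e : Pair) : 0 < len e := sub_pos.2 e.2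

/-- The constant in the bound `P(u ∼ v) ≤ edgeConst β / |u - v|²`. -/
noncomputable def edgeConst (β : ℝ≥0) : ℝ := max 1 (4 * β)

theorem edgeConst_pos (β : ℝ≥0) : 0 < edgeConst β := lt_max_of_lt_left one_pos

theorem integral_le {i j : ℝ} (h : i + 2 ≤ j) :
    ∫ u in i..(i + 1), ∫ v in j..(j + 1), 1 / |u - v| ^ 2 ≤ 4 / (j - i) ^ 2 := by
  have key : ∀ u ∈ uIoc i (i + 1), ∀ v ∈ uIoc j (j + 1),
      ‖1 / |u - v| ^ 2‖ ≤ 4 / (j - i) ^ 2 := by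
    intro u hu v hv
    rw [uIoc_of_le (by linarith)] at hu hv
    have h1 : 0 < j - i := by linarith
    -- The points are at distance at least `j - i - 1`, which is at least `(j - i) / 2` because `j -
    -- i ≥ 2`.
    have h2 : (j - i) / 2 ≤ |u - v| := by
      rw [abs_sub_comm]
      refine le_trans ?_ (le_abs_self _)
      linarith [hu.2, hv.1]
    have h3 : 0 < |u - v| := by linarith
    rw [Real.norm_of_nonneg (by positivity), div_le_div_iff₀ (by positivity) (by positivity)]
    nlinarith
  have h1 : ∀ u ∈ uIoc i (i + 1),
      ‖∫ v in j..(j + 1), 1 / |u - v| ^ 2‖ ≤ 4 / (j - i) ^ 2 := by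
    intro u hu
    have := intervalIntegral.norm_integral_le_of_norm_le_const (key u hu)
    simpa using this
  have h2 := intervalIntegral.norm_integral_le_of_norm_le_const h1
  refine (le_abs_self _).trans ?_
  simpa using h2

theorem exp_le_one_sub_edgeProb (β : ℝ≥0) (e : Pair) (he : 2 ≤ len e) :
    Real.exp (-(4 * β / (len e : ℝ) ^ 2)) ≤ 1 - (edgeProb β e : ℝ) := by
  have hne : e.1.2 ≠ e.1.1 + 1 := by unfold len at he; omega
  have h2 : (e.1.1 : ℝ) + 2 ≤ e.1.2 := by
    unfold len at he
    have : e.1.1 + 2 ≤ e.1.2 := by omega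
    exact_mod_cast this
  have h3 := integral_le h2
  rw [edgeProb, if_neg hne]
  simp only [sub_sub_cancel]
  rw [Real.exp_le_exp, neg_le_neg_iff, mul_comm (4 : ℝ), mul_div_assoc]
  refine mul_le_mul_of_nonneg_left ?_ β.2
  unfold len
  push_cast
  exact h3

/-- The maximum with `1` in `edgeConst` covers the nearest-neighbour edges, which are present surely
rather than by the integral formula. -/
theorem edgeProb_le (β : ℝ≥0) (e : Pair) :
    (edgeProb β e : ℝ) ≤ edgeConst β / (len e : ℝ) ^ 2 := by
  have hpos := len_pos e
  rcases (show len e = 1 ∨ 2 ≤ len e by omega) with h | h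
  · rw [h]
    have h1 : (edgeProb β e : ℝ) ≤ edgeConst β := (edgeProb β e).2.2.trans (le_max_left _ _)
    simpa using h1
  · have h1 := exp_le_one_sub_edgeProb β e h
    have h2 := Real.add_one_le_exp (-(4 * β / (len e : ℝ) ^ 2))
    have h3 : 4 * β / (len e : ℝ) ^ 2 ≤ edgeConst β / (len e : ℝ) ^ 2 := by
      gcongr
      exact le_max_right _ _
    linarith

/-! ### The law -/

instance (β : ℝ≥0) : IsProbabilityMeasure (law β) := by
  unfold law; infer_instance

theorem law_eval (β : ℝ≥0) (e : Pair) (s : Set Bool) :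
    law β {ω | ω e ∈ s} = bernoulliMeasure true false (edgeProb β e) s := by
  have := (measurePreserving_eval_infinitePi
    (fun e => bernoulliMeasure true false (edgeProb β e)) e).measure_preimage
      (s := s) (MeasurableSet.of_discrete.nullMeasurableSet)
  exact this

theorem law_open (β : ℝ≥0) (e : Pair) :
    law β {ω | ω e = true} = ENNReal.ofReal (edgeProb β e) := by
  have := law_eval β e {true}
  rw [bernoulliMeasure_apply_of_mem_of_notMem _ (by simp) (by simp) (by simp)] at this
  rw [ENNReal.ofReal]
  rw [Real.toNNReal_of_nonneg (edgeProb β e).2.1]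
  exact this

theorem law_forall_closed (β : ℝ≥0) (T : Finset Pair) :
    law β {ω | ∀ e ∈ T, ω e = false} = ∏ e ∈ T, ENNReal.ofReal (1 - edgeProb β e) := by
  have h := Measure.infinitePi_pi (fun e => bernoulliMeasure true false (edgeProb β e))
    (s := T) (t := fun _ => {false}) (fun _ _ => by simp)
  have h2 : {ω : Pair → Bool | ∀ e ∈ T, ω e = false} = (T : Set Pair).pi fun _ => {false} := by
    ext; simp [Set.mem_pi]
  rw [h2]
  refine h.trans (Finset.prod_congr rfl fun e _ => ?_)
  have h3 := prob_compl_eq_one_sub (μ := law β) (s := {ω | ω e = true})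
    (measurableSet_eq_fun (measurable_pi_apply e) measurable_const)
  rw [law_open] at h3
  have h4 : {ω : Pair → Bool | ω e = true}ᶜ = {ω | ω e ∈ ({false} : Set Bool)} := by
    ext; simp
  rw [h4, law_eval] at h3
  rw [h3, ENNReal.ofReal_sub _ (edgeProb β e).2.1, ENNReal.ofReal_one]

theorem exp_le_law_forall_closed (β : ℝ≥0) (T : Finset Pair) (hT : ∀ e ∈ T, 2 ≤ len e) :
    ENNReal.ofReal (Real.exp (-∑ e ∈ T, 4 * β / (len e : ℝ) ^ 2)) ≤
      law β {ω | ∀ e ∈ T, ω e = false} := by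
  rw [law_forall_closed, ← Finset.sum_neg_distrib, Real.exp_sum,
    ENNReal.ofReal_prod_of_nonneg fun _ _ => (Real.exp_pos _).le]
  exact Finset.prod_le_prod' fun e he =>
    ENNReal.ofReal_le_ofReal (exp_le_one_sub_edgeProb β e (hT e he))

/-! ### Sums over incident edges -/

/-- The edges of length at least `D` incident to `I`. -/
def incident (I : Finset ℤ) (D : ℤ) : Set Pair := {e | (e.1.1 ∈ I ∨ e.1.2 ∈ I) ∧ D ≤ len e}

theorem sum_inv_sq_le {ι : Type*} (T : Finset ι) (g : ι → ℤ) {D : ℤ} (hD : 1 ≤ D)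
    (hg : ∀ i ∈ T, D ≤ g i) (hinj : Set.InjOn g T) :
    ∑ i ∈ T, ((g i : ℝ) ^ 2)⁻¹ ≤ 2 / D := by
  classical
  obtain ⟨n, hn⟩ : ∃ n : ℕ, ∀ i ∈ T, g i < n := by
    obtain ⟨N, hN⟩ := (T.image g).bddAbove
    refine ⟨N.toNat + 1, fun i hi => ?_⟩
    have := hN (Finset.mem_coe.2 (Finset.mem_image_of_mem g hi))
    push_cast
    omega
  have h1 : ∑ i ∈ T, ((g i : ℝ) ^ 2)⁻¹ = ∑ k ∈ T.image fun i => (g i).toNat, ((k : ℝ) ^ 2)⁻¹ := by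
    rw [Finset.sum_image]
    · refine Finset.sum_congr rfl fun i hi => ?_
      have h2 : ((g i).toNat : ℤ) = g i := Int.toNat_of_nonneg (by have := hg i hi; omega)
      have h3 : ((g i).toNat : ℝ) = g i := by exact_mod_cast congrArg (Int.cast : ℤ → ℝ) h2
      rw [h3]
    · intro i hi j hj hij
      refine hinj hi hj ?_
      have := hg i hi
      have := hg j hj
      simp only at hij
      omega
  rw [h1]
  have h2 := sum_Ioo_inv_sq_le (α := ℝ) (D.toNat - 1) n
  have h3 : ((D.toNat - 1 : ℕ) : ℝ) + 1 = D := by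
    have : ((D.toNat - 1 : ℕ) : ℤ) + 1 = D := by omega
    exact_mod_cast congrArg (Int.cast : ℤ → ℝ) this
  rw [h3] at h2
  refine le_trans (Finset.sum_le_sum_of_subset_of_nonneg ?_ fun _ _ _ => by positivity) h2
  intro k hk
  obtain ⟨i, hi, rfl⟩ := Finset.mem_image.1 hk
  have := hg i hi
  have := hn i hi
  rw [Finset.mem_Ioo]
  omega

/-- A vertex is the left endpoint of at most one pair of each length, and likewise the right
endpoint. Each side contributes the tail `2 / D` of the inverse squares, which gives the factor
four. -/
theorem sum_incident_le (T : Finset Pair) (I : Finset ℤ) {D : ℤ} (hD : 1 ≤ D)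
    (hT : ∀ e ∈ T, e ∈ incident I D) {C : ℝ} (hC : 0 ≤ C) :
    ∑ e ∈ T, C / (len e : ℝ) ^ 2 ≤ I.card * (4 * C) / D := by
  classical
  have h1 : ∀ e ∈ T, C / (len e : ℝ) ^ 2 ≤ ∑ u ∈ I,
      ((if e.1.1 = u then C / (len e : ℝ) ^ 2 else 0) +
        (if e.1.2 = u then C / (len e : ℝ) ^ 2 else 0)) := by
    intro e he
    have hnn : 0 ≤ C / (len e : ℝ) ^ 2 := by positivity
    have hnn' : ∀ u ∈ I, 0 ≤ (if e.1.1 = u then C / (len e : ℝ) ^ 2 else 0) +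
        (if e.1.2 = u then C / (len e : ℝ) ^ 2 else 0) := by
      intro u _
      split_ifs <;> linarith
    rcases (hT e he).1 with h | h
    · refine le_trans ?_ (Finset.single_le_sum hnn' h)
      simp only [if_true]
      split_ifs <;> linarith
    · refine le_trans ?_ (Finset.single_le_sum hnn' h)
      simp only [if_true]
      split_ifs <;> linarith
  refine (Finset.sum_le_sum h1).trans ?_
  rw [Finset.sum_comm]
  have h2 : ∀ u ∈ I, ∑ e ∈ T, ((if e.1.1 = u then C / (len e : ℝ) ^ 2 else 0) +
        (if e.1.2 = u then C / (len e : ℝ) ^ 2 else 0)) ≤ 4 * C / D := by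
    intro u _
    rw [Finset.sum_add_distrib, ← Finset.sum_filter, ← Finset.sum_filter]
    have h3 := sum_inv_sq_le (T.filter fun e => e.1.1 = u) len hD
      (fun e he => (hT e (Finset.mem_filter.1 he).1).2) (by
        intro e he e' he' h
        have h3 := (Finset.mem_filter.1 he).2
        have h4 := (Finset.mem_filter.1 he').2
        unfold len at h
        exact Subtype.ext (Prod.ext (by omega) (by omega)))
    have h4 := sum_inv_sq_le (T.filter fun e => e.1.2 = u) len hD
      (fun e he => (hT e (Finset.mem_filter.1 he).1).2) (by
        intro e he e' he' h
        have h3 := (Finset.mem_filter.1 he).2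
        have h4 := (Finset.mem_filter.1 he').2
        unfold len at h
        exact Subtype.ext (Prod.ext (by omega) (by omega)))
    simp only [div_eq_mul_inv] at h3 h4 ⊢
    rw [← Finset.mul_sum, ← Finset.mul_sum, ← mul_add]
    calc C * _ ≤ C * (2 * (D : ℝ)⁻¹ + 2 * (D : ℝ)⁻¹) :=
          mul_le_mul_of_nonneg_left (add_le_add h3 h4) hC
      _ = _ := by ring
  refine (Finset.sum_le_sum h2).trans (le_of_eq ?_)
  rw [Finset.sum_const, nsmul_eq_mul]
  ring

/-- The expected number of edges of length at least `D` incident to `I`. -/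
theorem tsum_incident_le (β : ℝ≥0) (F : Set Pair) (I : Finset ℤ) {D : ℤ} (hD : 1 ≤ D)
    (hF : F ⊆ incident I D) :
    ∑' e : F, law β {ω | ω e = true} ≤ ENNReal.ofReal (I.card * (4 * edgeConst β) / D) := by
  refine ENNReal.summable.tsum_le_of_sum_le fun T => ?_
  have hC := (edgeConst_pos β).le
  calc ∑ e ∈ T, law β {ω | ω e.1 = true}
      ≤ ∑ e ∈ T, ENNReal.ofReal (edgeConst β / (len e.1 : ℝ) ^ 2) :=
        Finset.sum_le_sum fun e _ => by
          rw [law_open]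
          exact ENNReal.ofReal_le_ofReal (edgeProb_le β e)
    _ = ∑ e ∈ T.map (Function.Embedding.subtype _),
          ENNReal.ofReal (edgeConst β / (len e : ℝ) ^ 2) := by simp
    _ = ENNReal.ofReal (∑ e ∈ T.map (Function.Embedding.subtype _),
          edgeConst β / (len e : ℝ) ^ 2) :=
        (ENNReal.ofReal_sum_of_nonneg fun _ _ => by positivity).symm
    _ ≤ _ := by
      refine ENNReal.ofReal_le_ofReal (sum_incident_le _ I hD (fun e he => ?_) hC)
      obtain ⟨e', -, rfl⟩ := Finset.mem_map.1 he
      exact hF e'.2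

end LRP

namespace LRP

open MeasureTheory ProbabilityTheory Set

/-! ### Decreasing events -/

/-- The σ-algebra generated by the states of the edges in `F`. -/
@[reducible] def cyl (F : Set Pair) : MeasurableSpace (Pair → Bool) :=
  ⨆ e ∈ F, MeasurableSpace.comap (fun ω : Pair → Bool => ω e) ⊤

theorem cyl_mono {F G : Set Pair} (h : F ⊆ G) : cyl F ≤ cyl G :=
  biSup_mono fun _ he => h he

theorem cyl_le (F : Set Pair) : cyl F ≤ MeasurableSpace.pi :=
  iSup₂_le fun e _ => (measurable_pi_apply e).comap_le

theorem measurableSet_cyl_eval {F : Set Pair} {e : Pair} (he : e ∈ F) (s : Set Bool) :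
    MeasurableSet[cyl F] {ω : Pair → Bool | ω e ∈ s} :=
  (le_iSup₂ (f := fun e (_ : e ∈ F) => MeasurableSpace.comap (fun ω : Pair → Bool => ω e) ⊤) e he) _
    ⟨s, trivial, rfl⟩

/-- The decreasing events that depend only on the edges in `F`. -/
structure DecreasingOn (F : Set Pair) (A : Set (Pair → Bool)) : Prop where
  meas : MeasurableSet[cyl F] A
  lower : IsLowerSet A

namespace DecreasingOn

variable {F G : Set Pair} {A B : Set (Pair → Bool)}

theorem measurableSet (h : DecreasingOn F A) : MeasurableSet A := cyl_le F _ h.meas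

theorem mono (h : DecreasingOn F A) (hFG : F ⊆ G) : DecreasingOn G A :=
  ⟨cyl_mono hFG _ h.meas, h.lower⟩

theorem iInter {ι : Sort*} [Countable ι] {A : ι → Set (Pair → Bool)}
    (h : ∀ i, DecreasingOn F (A i)) : DecreasingOn F (⋂ i, A i) :=
  ⟨@MeasurableSet.iInter _ _ (cyl F) _ _ fun i => (h i).meas, isLowerSet_iInter fun i => (h i).lower⟩

theorem iUnion {ι : Sort*} [Countable ι] {A : ι → Set (Pair → Bool)}
    (h : ∀ i, DecreasingOn F (A i)) : DecreasingOn F (⋃ i, A i) :=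
  ⟨@MeasurableSet.iUnion _ _ (cyl F) _ _ fun i => (h i).meas, isLowerSet_iUnion fun i => (h i).lower⟩

theorem inter (hA : DecreasingOn F A) (hB : DecreasingOn F B) : DecreasingOn F (A ∩ B) :=
  ⟨@MeasurableSet.inter _ (cyl F) _ _ hA.meas hB.meas, hA.lower.inter hB.lower⟩

theorem union (hA : DecreasingOn F A) (hB : DecreasingOn F B) : DecreasingOn F (A ∪ B) :=
  ⟨@MeasurableSet.union _ (cyl F) _ _ hA.meas hB.meas, hA.lower.union hB.lower⟩

theorem closed {e : Pair} (he : e ∈ F) : DecreasingOn F {ω | ω e = false} := by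
  refine ⟨measurableSet_cyl_eval he {false}, fun ω ω' h hω => ?_⟩
  have := h e
  rw [mem_ofPred_eq] at hω ⊢
  rw [hω] at this
  exact le_bot_iff.1 this

end DecreasingOn

/-- The event that all edges in `F` are absent. -/
def NoEdge (F : Set Pair) : Set (Pair → Bool) := {ω | ∀ e ∈ F, ω e = false}

theorem decreasingOn_noEdge {F G : Set Pair} (h : F ⊆ G) : DecreasingOn G (NoEdge F) := by
  have : NoEdge F = ⋂ e : F, {ω : Pair → Bool | ω e = false} := by
    ext; simp [NoEdge]
  rw [this]
  exact DecreasingOn.iInter fun e => DecreasingOn.closed (h e.2)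

/-- The event that at most `W` edges in `F` are present. -/
def FewEdges (F : Set Pair) (W : ℕ) : Set (Pair → Bool) :=
  {ω | ∃ T : Finset Pair, T.card ≤ W ∧ ∀ e ∈ F, ω e = true → e ∈ T}

theorem decreasingOn_fewEdges {F G : Set Pair} (h : F ⊆ G) (W : ℕ) :
    DecreasingOn G (FewEdges F W) := by
  have : FewEdges F W = ⋃ T : {T : Finset Pair // T.card ≤ W}, NoEdge (F \ T.1) := by
    ext ω
    simp only [FewEdges, NoEdge, mem_ofPred_eq, mem_iUnion, Subtype.exists, exists_prop, mem_sdiff,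
      Finset.mem_coe]
    refine exists_congr fun T => and_congr_right fun _ => forall_congr' fun e => ?_
    cases ω e <;> simp
  rw [this]
  exact DecreasingOn.iUnion fun T => decreasingOn_noEdge (sdiff_subset.trans h)

/-- The configuration with the edges outside `F` removed. -/
noncomputable def keep (F : Set Pair) (ω : Pair → Bool) : Pair → Bool := by
  classical exact fun e => if e ∈ F then ω e else false

theorem keep_of_mem {F : Set Pair} {e : Pair} (h : e ∈ F) (ω : Pair → Bool) :
    keep F ω e = ω e := if_pos h

theorem keep_of_notMem {F : Set Pair} {e : Pair} (h : e ∉ F) (ω : Pair → Bool) :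
    keep F ω e = false := if_neg h

theorem keep_le (F : Set Pair) (ω : Pair → Bool) : keep F ω ≤ ω := by
  intro e
  by_cases h : e ∈ F
  · rw [keep_of_mem h]
  · rw [keep_of_notMem h]; exact bot_le

theorem keep_mono (F : Set Pair) {ω ω' : Pair → Bool} (hω : ω ≤ ω') : keep F ω ≤ keep F ω' := by
  intro e
  by_cases h : e ∈ F
  · rw [keep_of_mem h, keep_of_mem h]; exact hω e
  · rw [keep_of_notMem h]; exact bot_le

/-- Localisation: testing a decreasing event on the truncated configuration makes it depend on `F`
alone. Together with `subset_keep_preimage`, which says that its probability does not drop, this is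
the source of all independence between crossing events. -/
theorem decreasingOn_keep {F G : Set Pair} {A : Set (Pair → Bool)} (hA : DecreasingOn G A) :
    DecreasingOn F (keep F ⁻¹' A) := by
  refine ⟨?_, fun ω ω' h hω => hA.lower (keep_mono F h) hω⟩
  have hm : @Measurable _ _ (cyl F) MeasurableSpace.pi (keep F) := by
    refine @measurable_pi_iff _ _ _ (cyl F) _ _ |>.2 fun e => ?_
    by_cases h : e ∈ F
    · simp only [keep_of_mem h]
      exact fun s _ => measurableSet_cyl_eval h s
    · simp only [keep_of_notMem h]
      exact @measurable_const _ _ _ (cyl F) _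
  exact hm hA.measurableSet

theorem subset_keep_preimage {F G : Set Pair} {A : Set (Pair → Bool)} (hA : DecreasingOn G A) :
    A ⊆ keep F ⁻¹' A := fun ω hω => hA.lower (keep_le F ω) hω

/-! ### Probabilities -/

theorem law_compl_noEdge_le (β : ℝ≥0) {F : Set Pair} {I : Finset ℤ} {D : ℤ} (hD : 1 ≤ D)
    (hF : F ⊆ incident I D) :
    law β (NoEdge F)ᶜ ≤ ENNReal.ofReal (I.card * (4 * edgeConst β) / D) := by
  refine le_trans ?_ (tsum_incident_le β F I hD hF)
  have : (NoEdge F)ᶜ = ⋃ e : F, {ω : Pair → Bool | ω e = true} := by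
    ext; simp [NoEdge]
  rw [this]
  exact measure_iUnion_le _

/-- Independence gives a positive bound even when the expected number of edges is not small, where
the union bound of `law_compl_noEdge_le` is empty. The condition `2 ≤ D` excludes the edges that are
always present. -/
theorem le_law_noEdge (β : ℝ≥0) {F : Set Pair} (hfin : F.Finite) {I : Finset ℤ} {D : ℤ}
    (hD : 2 ≤ D) (hF : F ⊆ incident I D) :
    ENNReal.ofReal (Real.exp (-(I.card * (16 * β) / D))) ≤ law β (NoEdge F) := by
  have h1 := exp_le_law_forall_closed β hfin.toFinset fun e he => by
    have := (hF (hfin.mem_toFinset.1 he)).2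
    omega
  have h2 := sum_incident_le hfin.toFinset I (by omega : 1 ≤ D)
    (fun e he => hF (hfin.mem_toFinset.1 he)) (C := 4 * β) (by positivity)
  have h3 : {ω : Pair → Bool | ∀ e ∈ hfin.toFinset, ω e = false} = NoEdge F := by
    ext; simp [NoEdge]
  rw [h3] at h1
  refine le_trans (ENNReal.ofReal_le_ofReal (Real.exp_le_exp.2 (neg_le_neg ?_))) h1
  refine h2.trans (le_of_eq ?_)
  ring

/-- Markov's inequality for the number of open edges in `F`. -/
theorem law_compl_fewEdges_le (β : ℝ≥0) {F : Set Pair} {I : Finset ℤ} {D : ℤ} (hD : 1 ≤ D)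
    (hF : F ⊆ incident I D) {W : ℕ} (hW : 0 < W) :
    law β (FewEdges F W)ᶜ ≤ ENNReal.ofReal (I.card * (4 * edgeConst β) / D / W) := by
  classical
  set X : (Pair → Bool) → ℝ≥0∞ := fun ω => ∑' e : F, {ω : Pair → Bool | ω e = true}.indicator 1 ω
    with hX
  have hmeas : ∀ e : Pair, MeasurableSet {ω : Pair → Bool | ω e = true} := fun e =>
    measurableSet_eq_fun (measurable_pi_apply e) measurable_const
  have hXm : Measurable X := Measurable.tsum fun e => measurable_one.indicator (hmeas e)
  have hEX : ∫⁻ ω, X ω ∂(law β) ≤ ENNReal.ofReal (I.card * (4 * edgeConst β) / D) := by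
    simp only [hX]
    rw [lintegral_tsum fun e : F => (measurable_one.indicator (hmeas e)).aemeasurable]
    refine le_trans (le_of_eq ?_) (tsum_incident_le β F I hD hF)
    exact tsum_congr fun e => lintegral_indicator_one (hmeas e)
  have hsub : (FewEdges F W)ᶜ ⊆ {ω | (W : ℝ≥0∞) ≤ X ω} := by
    intro ω hω
    -- Greedy choice: as long as fewer than `W` open edges are chosen they do not exhaust the open
    -- edges of `F`, so another can be added.
    have key : ∀ k ≤ W, ∃ T : Finset Pair, T.card = k ∧ ∀ e ∈ T, e ∈ F ∧ ω e = true := by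
      intro k
      induction k with
      | zero => exact fun _ => ⟨∅, rfl, by simp⟩
      | succ k ih =>
        intro hk
        obtain ⟨T, hT, hT'⟩ := ih (by omega)
        have : ∃ e ∈ F, ω e = true ∧ e ∉ T := by
          by_contra hcon
          push Not at hcon
          exact hω ⟨T, by omega, hcon⟩
        obtain ⟨e, he, he', heT⟩ := this
        refine ⟨insert e T, by rw [Finset.card_insert_of_notMem heT, hT], fun e' h => ?_⟩
        rcases Finset.mem_insert.1 h with rfl | h
        · exact ⟨he, he'⟩
        · exact hT' e' h
    obtain ⟨T, hT, hT'⟩ := key W le_rfl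
    have h1 := ENNReal.sum_le_tsum (f := fun e : F => {ω : Pair → Bool | ω e = true}.indicator
      (1 : (Pair → Bool) → ℝ≥0∞) ω) (T.subtype (· ∈ F))
    refine le_trans (le_of_eq ?_) h1
    have h2 : ∑ e ∈ T.subtype (· ∈ F), {ω : Pair → Bool | ω e = true}.indicator
        (1 : (Pair → Bool) → ℝ≥0∞) ω = ∑ e ∈ T.subtype (· ∈ F), 1 := by
      refine Finset.sum_congr rfl fun e he => ?_
      rw [indicator_of_mem]
      · rfl
      · exact (hT' _ (Finset.mem_subtype.1 he)).2
    rw [h2, Finset.sum_const, Finset.card_subtype, Finset.filter_true_of_mem fun e he => (hT' e he).1,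
      hT]
    simp
  have h3 := (mul_meas_ge_le_lintegral (μ := law β) hXm W).trans hEX
  have hW0 : (W : ℝ≥0∞) ≠ 0 := by exact_mod_cast hW.ne'
  rw [ENNReal.ofReal_div_of_pos (by exact_mod_cast hW), ENNReal.ofReal_natCast,
    ENNReal.le_div_iff_mul_le (Or.inl hW0) (Or.inl (ENNReal.natCast_ne_top W)), mul_comm]
  exact (mul_le_mul_right (measure_mono hsub) _).trans h3

theorem indep_cyl (β : ℝ≥0) {F G : Set Pair} (h : Disjoint F G) :
    Indep (cyl F) (cyl G) (law β) := by
  have h1 : iIndepFun (fun (e : Pair) (ω : Pair → Bool) => ω e) (law β) :=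
    iIndepFun_infinitePi (P := fun e => bernoulliMeasure true false (edgeProb β e))
      (X := fun _ b => b) fun _ => measurable_id
  exact indep_iSup_of_disjoint (fun e => (measurable_pi_apply e).comap_le) h1.iIndep h

theorem law_inter (β : ℝ≥0) {F G : Set Pair} (h : Disjoint F G) {A B : Set (Pair → Bool)}
    (hA : MeasurableSet[cyl F] A) (hB : MeasurableSet[cyl G] B) :
    law β (A ∩ B) = law β A * law β B :=
  (Indep_iff _ _ _).1 (indep_cyl β h) A B hA hB

theorem law_iInter_le_pow (β : ℝ≥0) {η : ℝ≥0∞} (q : ℕ) (F : ℕ → Set Pair)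
    (A : ℕ → Set (Pair → Bool)) (hA : ∀ i < q, MeasurableSet[cyl (F i)] (A i))
    (hF : ∀ i < q, ∀ j < i, Disjoint (F i) (F j)) (hη : ∀ i < q, law β (A i) ≤ η) :
    law β (⋂ i : Fin q, A i) ≤ η ^ q := by
  suffices h : ∀ k ≤ q, MeasurableSet[cyl (⋃ i < k, F i)] (⋂ i < k, A i) ∧
      law β (⋂ i < k, A i) ≤ η ^ k by
    refine le_trans (measure_mono ?_) (h q le_rfl).2
    intro ω hω
    simp only [mem_iInter] at hω ⊢
    exact fun i hi => hω ⟨i, hi⟩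
  intro k
  induction k with
  | zero =>
    intro _
    have : (⋂ i < 0, A i) = Set.univ := by simp
    rw [this]
    exact ⟨@MeasurableSet.univ _ (cyl _), by simp⟩
  | succ k ih =>
    intro hk
    obtain ⟨h1, h2⟩ := ih (by omega)
    have h3 : (⋂ i < k + 1, A i) = (⋂ i < k, A i) ∩ A k := by
      ext ω
      simp only [mem_iInter, mem_inter_iff]
      constructor
      · exact fun h => ⟨fun i hi => h i (by omega), h k (by omega)⟩
      · rintro ⟨h, h'⟩ i hi
        rcases Nat.lt_succ_iff_lt_or_eq.1 hi with hi | rfl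
        · exact h i hi
        · exact h'
    have hsub1 : (⋃ i < k, F i) ⊆ ⋃ i < k + 1, F i :=
      biUnion_mono (fun i (hi : i < k) => Nat.lt_succ_of_lt hi) fun _ _ => subset_rfl
    have hsub2 : F k ⊆ ⋃ i < k + 1, F i := subset_biUnion_of_mem (u := F) (Nat.lt_succ_self k)
    rw [h3]
    refine ⟨@MeasurableSet.inter _ (cyl _) _ _ (cyl_mono hsub1 _ h1)
      (cyl_mono hsub2 _ (hA k (by omega))), ?_⟩
    rw [law_inter β _ h1 (hA k (by omega)), pow_succ]
    · exact mul_le_mul' h2 (hη k (by omega))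
    · simp only [disjoint_iUnion_left]
      exact fun i hi => (hF k (by omega) i hi).symm

end LRP

/-! ### Independent trials and hard sub-blocks. -/

namespace LRP

open MeasureTheory ProbabilityTheory Set

/-- The edges whose endpoints are related by `P`, in some order. -/
def pairsOf (P : ℤ → ℤ → Prop) : Set Pair := {e | P e.1.1 e.1.2 ∨ P e.1.2 e.1.1}

theorem exists_pair_of_adj {ω : Pair → Bool} {u v : ℤ} (h : (graph ω).Adj u v) :
    ∃ e : Pair, ω e = true ∧ (e.1 = (u, v) ∨ e.1 = (v, u)) := by
  rcases h with ⟨h, h'⟩ | ⟨h, h'⟩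
  · exact ⟨_, h', Or.inl rfl⟩
  · exact ⟨_, h', Or.inr rfl⟩

theorem not_adj_of_noEdge {ω : Pair → Bool} {P : ℤ → ℤ → Prop} (h : ω ∈ NoEdge (pairsOf P))
    {u v : ℤ} (huv : P u v) : ¬ (graph ω).Adj u v := by
  intro hadj
  obtain ⟨e, he, h1⟩ := exists_pair_of_adj hadj
  have h2 : e ∈ pairsOf P := by
    rcases h1 with h1 | h1
    · exact Or.inl (by rw [h1]; exact huv)
    · exact Or.inr (by rw [h1]; exact huv)
  rw [h e h2] at he
  cases he

theorem adj_keep {ω : Pair → Bool} {P : ℤ → ℤ → Prop} {u v : ℤ} (h : (graph ω).Adj u v)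
    (huv : P u v) : (graph (keep (pairsOf P) ω)).Adj u v := by
  rcases h with ⟨h, h'⟩ | ⟨h, h'⟩
  · exact Or.inl ⟨h, by rw [keep_of_mem (Or.inl huv)]; exact h'⟩
  · exact Or.inr ⟨h, by rw [keep_of_mem (Or.inr huv)]; exact h'⟩

/-- A union bound over the `G` groups; within a group all `q` independent trials have to fail. -/
theorem law_compl_groups_le (β : ℝ≥0) {η : ℝ≥0∞} (G q : ℕ) (F : ℕ → Set Pair)
    (E : ℕ → Set (Pair → Bool)) (hE : ∀ i < G * q, DecreasingOn (F i) (E i))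
    (hF : ∀ i < G * q, ∀ j < i, Disjoint (F i) (F j)) (hη : ∀ i < G * q, law β (E i)ᶜ ≤ η) :
    law β (⋂ g : Fin G, ⋃ i : Fin q, E (g * q + i))ᶜ ≤ G * η ^ q := by
  have h1 : (⋂ g : Fin G, ⋃ i : Fin q, E (g * q + i))ᶜ =
      ⋃ g : Fin G, ⋂ i : Fin q, (E (g * q + i))ᶜ := by
    simp only [compl_iInter, compl_iUnion]
  have hlt : ∀ g : Fin G, ∀ i < q, (g : ℕ) * q + i < G * q := fun g i hi => by
    have : ((g : ℕ) + 1) * q ≤ G * q := Nat.mul_le_mul_right q g.2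
    rw [add_mul, one_mul] at this
    omega
  rw [h1]
  calc law β (⋃ g : Fin G, ⋂ i : Fin q, (E (g * q + i))ᶜ)
      ≤ ∑' g : Fin G, law β (⋂ i : Fin q, (E (g * q + i))ᶜ) := measure_iUnion_le _
    _ = ∑ g : Fin G, law β (⋂ i : Fin q, (E (g * q + i))ᶜ) := tsum_fintype _
    _ ≤ ∑ g : Fin G, η ^ q := by
      refine Finset.sum_le_sum fun g _ => ?_
      refine law_iInter_le_pow β q (fun i => F (g * q + i)) (fun i => (E (g * q + i))ᶜ)
        (fun i hi => @MeasurableSet.compl _ _ (cyl _) (hE _ (hlt g i hi)).meas)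
        (fun i hi j hj => hF _ (hlt g i hi) _ (by omega)) fun i hi => hη _ (hlt g i hi)
    _ = G * η ^ q := by simp

/-- With probability at least `1 - α` a block of length `ℓ` has crossing resistance at least `r`,
in the sense that this holds on a decreasing event. -/
def Robust (β : ℝ≥0) (α : ℝ) (ℓ : ℤ) (r : ℝ) : Prop :=
  ∀ a : ℤ, ∃ S : Set (Pair → Bool), DecreasingOn univ S ∧ law β Sᶜ ≤ ENNReal.ofReal α ∧
    ∀ ω ∈ S, Crossing ω a (a + ℓ) r

theorem law_compl_keep_le {β : ℝ≥0} {α : ℝ} {F : Set Pair} {S : Set (Pair → Bool)}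
    (hS : DecreasingOn univ S) (h : law β Sᶜ ≤ ENNReal.ofReal α) :
    law β (keep F ⁻¹' S)ᶜ ≤ ENNReal.ofReal α :=
  (measure_mono (compl_subset_compl.2 (subset_keep_preimage hS))).trans h

/-- Among well separated blocks, each of `G` groups contains a block that is hard to cross. -/
theorem exists_hard_blocks {β : ℝ≥0} {α r : ℝ} {ℓ D : ℤ} (hα : 0 ≤ α) (hℓ : 0 < ℓ)
    (hD : 1 ≤ D) (h : Robust β α ℓ r) (G q : ℕ) (c : ℕ → ℤ)
    (hc : ∀ i j, i < j → c i + ℓ + D ≤ c j) :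
    ∃ S, DecreasingOn univ S ∧
      law β Sᶜ ≤ ENNReal.ofReal (G * α ^ q + G * q * ℓ * (4 * edgeConst β) / D) ∧
      ∀ ω ∈ S, ∀ g : Fin G, ∃ i : Fin q, Crossing ω (c (g * q + i)) (c (g * q + i) + ℓ) r := by
  classical
  choose S hS hlaw hcross using fun i => h (c i)
  have hne : ∀ i j u, u ∈ Ioc (c i) (c i + ℓ) → u ∈ Ioc (c j) (c j + ℓ) → i = j := by
    intro i j u hi hj
    simp only [mem_Ioc] at hi hj
    rcases lt_trichotomy i j with hij | hij | hij
    · have := hc i j hij; omega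
    · exact hij
    · have := hc j i hij; omega
  -- The edges of block `i` that avoid the other blocks form pairwise disjoint sets. The remaining
  -- incident edges join two blocks; these are forbidden through `N`, which is cheap because the
  -- blocks are far apart.
  set P : ℕ → ℤ → ℤ → Prop := fun i u v =>
    u ∈ Ioc (c i) (c i + ℓ) ∧ ∀ j < G * q, j ≠ i → v ∉ Ioc (c j) (c j + ℓ) with hP
  set N : ℤ → ℤ → Prop := fun u v => ∃ i < G * q, ∃ j < G * q, i ≠ j ∧
    u ∈ Ioc (c i) (c i + ℓ) ∧ v ∈ Ioc (c j) (c j + ℓ) with hN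
  set I : Finset ℤ := (Finset.range (G * q)).biUnion fun i => Finset.Ioc (c i) (c i + ℓ) with hI
  have hIcard : (I.card : ℝ) ≤ G * q * ℓ := by
    have h1 : I.card ≤ ∑ i ∈ Finset.range (G * q), (Finset.Ioc (c i) (c i + ℓ)).card :=
      Finset.card_biUnion_le
    simp only [Int.card_Ioc, add_sub_cancel_left, Finset.sum_const, Finset.card_range,
      smul_eq_mul] at h1
    have h2 : ((ℓ.toNat : ℕ) : ℝ) = ℓ := by
      exact_mod_cast congrArg (Int.cast : ℤ → ℝ) (Int.toNat_of_nonneg hℓ.le)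
    calc (I.card : ℝ) ≤ ((G * q * ℓ.toNat : ℕ) : ℝ) := by exact_mod_cast h1
      _ = G * q * ℓ := by push_cast; rw [h2]
  have hNinc : pairsOf N ⊆ incident I D := by
    intro e he
    have hlt := e.2
    rcases he with ⟨i, hi, j, hj, hij, hu, hv⟩ | ⟨i, hi, j, hj, hij, hu, hv⟩
    · refine ⟨Or.inl ?_, ?_⟩
      · rw [hI, Finset.mem_biUnion]
        exact ⟨i, Finset.mem_range.2 hi, Finset.mem_Ioc.2 hu⟩
      · simp only [mem_Ioc] at hu hv
        unfold len
        rcases lt_or_gt_of_ne hij with h' | h'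
        · have := hc i j h'; omega
        · have := hc j i h'; omega
    · refine ⟨Or.inr ?_, ?_⟩
      · rw [hI, Finset.mem_biUnion]
        exact ⟨i, Finset.mem_range.2 hi, Finset.mem_Ioc.2 hu⟩
      · simp only [mem_Ioc] at hu hv
        unfold len
        rcases lt_or_gt_of_ne hij with h' | h'
        · have := hc i j h'; omega
        · have := hc j i h'; omega
  refine ⟨NoEdge (pairsOf N) ∩
    ⋂ g : Fin G, ⋃ i : Fin q, keep (pairsOf (P (g * q + i))) ⁻¹' S (g * q + i), ?_, ?_, ?_⟩
  · exact (decreasingOn_noEdge (subset_univ _)).inter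
      (DecreasingOn.iInter fun g => DecreasingOn.iUnion fun i =>
        (decreasingOn_keep (hS _)).mono (subset_univ _))
  · have hC := (edgeConst_pos β).le
    have hℓ' : (0 : ℝ) ≤ ℓ := by exact_mod_cast hℓ.le
    have hD' : (0 : ℝ) < D := by exact_mod_cast (by omega : 0 < D)
    rw [compl_inter, add_comm, ENNReal.ofReal_add (by positivity) (by positivity)]
    refine (measure_union_le _ _).trans (add_le_add ?_ ?_)
    · refine (law_compl_noEdge_le β hD hNinc).trans (ENNReal.ofReal_le_ofReal ?_)
      gcongr
    · rw [ENNReal.ofReal_mul (by positivity), ENNReal.ofReal_natCast, ENNReal.ofReal_pow hα]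
      refine law_compl_groups_le β G q (fun i => pairsOf (P i))
        (fun i => keep (pairsOf (P i)) ⁻¹' S i)
        (fun i _ => decreasingOn_keep (hS i)) ?_ fun i _ => law_compl_keep_le (hS i) (hlaw i)
      intro i hi j hj
      have hji : j < G * q := hj.trans hi
      rw [Set.disjoint_left]
      rintro e (⟨h1, h2⟩ | ⟨h1, h2⟩) (⟨h3, h4⟩ | ⟨h3, h4⟩)
      · exact hj.ne' (hne _ _ _ h1 h3)
      · exact h2 j hji hj.ne h3
      · exact h2 j hji hj.ne h3
      · exact hj.ne' (hne _ _ _ h1 h3)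
  · rintro ω ⟨hω1, hω2⟩ g
    obtain ⟨i, hi⟩ := mem_iUnion.1 (mem_iInter.1 hω2 g)
    refine ⟨i, (hcross _ _ hi).of_adj fun u hu v hadj => adj_keep hadj ⟨hu, fun j hj hji hv => ?_⟩⟩
    have hlt : (g : ℕ) * q + i < G * q := by
      have : ((g : ℕ) + 1) * q ≤ G * q := Nat.mul_le_mul_right q g.2
      rw [add_mul, one_mul] at this
      omega
    exact not_adj_of_noEdge hω1 ⟨_, hlt, j, hj, hji.symm, hu, hv⟩ hadj

end LRP

/-! ### Good annuli around an endpoint of a long edge. -/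

namespace LRP

open MeasureTheory ProbabilityTheory Set

/-- The two blocks adjacent to `(x - ρ, x + ρ]` are hard to cross, and a flow that enters `x`
along the edge `{x, y}` has to cross them. -/
structure GoodAnnulus (ω : Pair → Bool) (x y ρ : ℤ) (r : ℝ) : Prop where
  left : Crossing ω (x - 2 * ρ) (x - ρ) r
  right : Crossing ω (x + ρ) (x + 2 * ρ) r
  center : ∀ u ∈ Ioc (x - ρ) (x + ρ), ∀ v ∉ Ioc (x - 2 * ρ) (x + 2 * ρ),
    (graph ω).Adj u v → u = x ∧ v = y
  left_right : ∀ u ∈ Ioc (x - 2 * ρ) (x - ρ), ∀ v, x + ρ < v → ¬ (graph ω).Adj u v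
  right_left : ∀ u ∈ Ioc (x + ρ) (x + 2 * ρ), ∀ v, v ≤ x - ρ → ¬ (graph ω).Adj u v

/-- The pairs in the ball of radius `σ` around `x` that do not lie in the ball of radius `ρ`. -/
def shell (x ρ σ : ℤ) (u v : ℤ) : Prop :=
  (u ∈ Ioc (x - σ) (x + σ) ∧ v ∈ Ioc (x - σ) (x + σ)) ∧
    ¬ (u ∈ Ioc (x - ρ) (x + ρ) ∧ v ∈ Ioc (x - ρ) (x + ρ))

/-- The pairs forbidden in a good annulus. -/
def shortcut (x ρ : ℤ) (u v : ℤ) : Prop :=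
  (u ∈ Ioc (x - ρ) (x + ρ) ∧ v ∉ Ioc (x - 2 * ρ) (x + 2 * ρ)) ∨
  (u ∈ Ioc (x - 2 * ρ) (x - ρ) ∧ x + ρ < v) ∨ (u ∈ Ioc (x + ρ) (x + 2 * ρ) ∧ v ≤ x - ρ)

/-- Shortcuts touch `4 ρ` vertices and have length above `ρ`, so all those in the shell are absent
with probability at least `exp (-64 β)`, whatever `ρ` and `σ`. The two crossing failures cost at
most `2 α`, half of this, by the assumed threshold on `α`. -/
theorem exists_local_annulus {β : ℝ≥0} {α r : ℝ} {x ρ σ : ℤ} (hρ : 1 ≤ ρ)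
    (h : Robust β α ρ r) (hα : 0 ≤ α) (hαβ : α ≤ Real.exp (-(64 * β)) / 4) :
    ∃ E, DecreasingOn (pairsOf (shell x ρ σ)) E ∧
      law β Eᶜ ≤ ENNReal.ofReal (1 - Real.exp (-(64 * β)) / 2) ∧
      ∀ ω ∈ E, Crossing (keep (pairsOf (shell x ρ σ)) ω) (x - 2 * ρ) (x - ρ) r ∧
        Crossing (keep (pairsOf (shell x ρ σ)) ω) (x + ρ) (x + 2 * ρ) r ∧
        ω ∈ NoEdge (pairsOf fun u v => shortcut x ρ u v ∧ shell x ρ σ u v) := by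
  obtain ⟨S₁, hS₁, hlaw₁, hcross₁⟩ := h (x - 2 * ρ)
  obtain ⟨S₂, hS₂, hlaw₂, hcross₂⟩ := h (x + ρ)
  rw [show x - 2 * ρ + ρ = x - ρ by ring] at hcross₁
  rw [show x + ρ + ρ = x + 2 * ρ by ring] at hcross₂
  set F := pairsOf (shell x ρ σ) with hF
  set N := pairsOf fun u v => shortcut x ρ u v ∧ shell x ρ σ u v with hN
  have hNF : N ⊆ F := fun e he => he.imp And.right And.right
  have hfin : N.Finite := by
    have h1 : F ⊆ Subtype.val ⁻¹' (Icc (x - σ) (x + σ) ×ˢ Icc (x - σ) (x + σ)) := by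
      rintro e (⟨⟨h1, h2⟩, -⟩ | ⟨⟨h1, h2⟩, -⟩)
      · exact ⟨Ioc_subset_Icc_self h1, Ioc_subset_Icc_self h2⟩
      · exact ⟨Ioc_subset_Icc_self h2, Ioc_subset_Icc_self h1⟩
    refine (Set.Finite.subset ?_ h1).subset hNF
    exact ((finite_Icc _ _).prod (finite_Icc _ _)).preimage Subtype.val_injective.injOn
  have hinc : N ⊆ incident (Finset.Ioc (x - 2 * ρ) (x + 2 * ρ)) (ρ + 1) := by
    intro e he
    have hlt := e.2
    unfold incident len
    rcases he with ⟨he, -⟩ | ⟨he, -⟩ <;>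
    · simp only [shortcut, mem_Ioc, Finset.mem_Ioc, mem_ofPred_eq] at *
      omega
  have hNlaw : law β (NoEdge N)ᶜ ≤ ENNReal.ofReal (1 - Real.exp (-(64 * β))) := by
    rw [prob_compl_eq_one_sub (decreasingOn_noEdge hNF).measurableSet,
      ENNReal.ofReal_sub _ (Real.exp_pos _).le, ENNReal.ofReal_one]
    refine tsub_le_tsub_left (le_trans (ENNReal.ofReal_le_ofReal (Real.exp_le_exp.2 ?_))
      (le_law_noEdge β hfin (by omega) hinc)) _
    rw [neg_le_neg_iff, Int.card_Ioc]
    have h1 : (((x + 2 * ρ - (x - 2 * ρ)).toNat : ℕ) : ℝ) = 4 * ρ := by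
      have : ((x + 2 * ρ - (x - 2 * ρ)).toNat : ℤ) = 4 * ρ := by omega
      exact_mod_cast congrArg (Int.cast : ℤ → ℝ) this
    have h2 : (1 : ℝ) ≤ ρ := by exact_mod_cast hρ
    have h3 : (0 : ℝ) ≤ β := β.2
    rw [h1]
    push_cast
    rw [div_le_iff₀ (by linarith)]
    nlinarith
  refine ⟨keep F ⁻¹' S₁ ∩ keep F ⁻¹' S₂ ∩ NoEdge N, ?_, ?_, ?_⟩
  · exact ((decreasingOn_keep hS₁).inter (decreasingOn_keep hS₂)).inter (decreasingOn_noEdge hNF)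
  · rw [compl_inter, compl_inter]
    have hexp : Real.exp (-(64 * β)) ≤ 1 := Real.exp_le_one_iff.2 (by
      have : (0 : ℝ) ≤ β := β.2
      linarith)
    calc law β (((keep F ⁻¹' S₁)ᶜ ∪ (keep F ⁻¹' S₂)ᶜ) ∪ (NoEdge N)ᶜ)
        ≤ ENNReal.ofReal α + ENNReal.ofReal α + ENNReal.ofReal (1 - Real.exp (-(64 * β))) :=
          (measure_union_le _ _).trans (add_le_add ((measure_union_le _ _).trans
            (add_le_add (law_compl_keep_le hS₁ hlaw₁) (law_compl_keep_le hS₂ hlaw₂))) hNlaw)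
      _ = ENNReal.ofReal (α + α + (1 - Real.exp (-(64 * β)))) := by
          rw [ENNReal.ofReal_add (by linarith) (by linarith), ENNReal.ofReal_add hα hα]
      _ ≤ _ := ENNReal.ofReal_le_ofReal (by linarith)
  · rintro ω ⟨⟨h1, h2⟩, h3⟩
    exact ⟨hcross₁ _ h1, hcross₂ _ h2, h3⟩

/-- With high probability many annuli around an endpoint of an edge are good. -/
theorem exists_good_annuli {β : ℝ≥0} {α r : ℝ} (hα : 0 ≤ α)
    (hαβ : α ≤ Real.exp (-(64 * β)) / 4) (G q : ℕ) {x y : ℤ} (e₀ : Pair)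
    (he₀ : e₀.1 = (x, y) ∨ e₀.1 = (y, x)) {M : ℤ} (hM : 4 ≤ M) (ρ : ℕ → ℤ)
    (hρ0 : ∀ k, 1 ≤ ρ k) (hρ : ∀ k, M * ρ k ≤ ρ (k + 1)) (h : ∀ k < G * q, Robust β α (ρ k) r)
    (hy : y ∉ Ioc (x - ρ (G * q)) (x + ρ (G * q))) :
    ∃ S, DecreasingOn {e₀}ᶜ S ∧
      law β Sᶜ ≤ ENNReal.ofReal (G * (1 - Real.exp (-(64 * β)) / 2) ^ q +
        G * q * (32 * edgeConst β / M)) ∧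
      ∀ ω ∈ S, ∀ g : Fin G, ∃ i : Fin q, GoodAnnulus ω x y (ρ (g * q + i)) r := by
  classical
  have hstep : ∀ k, 4 * ρ k ≤ ρ (k + 1) := fun k => by
    have := hρ k
    have := hρ0 k
    nlinarith
  have hmono : Monotone ρ := monotone_nat_of_le_succ fun k => by
    have := hstep k
    have := hρ0 k
    omega
  have hlt : ∀ (g : Fin G) (i : Fin q), (g : ℕ) * q + i < G * q := fun g i => by
    have : ((g : ℕ) + 1) * q ≤ G * q := Nat.mul_le_mul_right q g.2
    rw [add_mul, one_mul] at this
    have := i.2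
    omega
  have hyk : ∀ k < G * q, y ∉ Ioc (x - ρ (k + 1)) (x + ρ (k + 1)) := by
    intro k hk hy'
    have := hmono (show k + 1 ≤ G * q by omega)
    refine hy ⟨?_, ?_⟩
    · have := hy'.1; omega
    · have := hy'.2; omega
  have hEx : ∀ k, ∃ E, k < G * q → DecreasingOn (pairsOf (shell x (ρ k) (ρ (k + 1)))) E ∧
      law β Eᶜ ≤ ENNReal.ofReal (1 - Real.exp (-(64 * β)) / 2) ∧
      ∀ ω ∈ E, Crossing (keep (pairsOf (shell x (ρ k) (ρ (k + 1)))) ω) (x - 2 * ρ k) (x - ρ k) r ∧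
        Crossing (keep (pairsOf (shell x (ρ k) (ρ (k + 1)))) ω) (x + ρ k) (x + 2 * ρ k) r ∧
        ω ∈ NoEdge (pairsOf fun u v => shortcut x (ρ k) u v ∧ shell x (ρ k) (ρ (k + 1)) u v) := by
    intro k
    by_cases hk : k < G * q
    · obtain ⟨E, hE⟩ := exists_local_annulus (x := x) (σ := ρ (k + 1)) (hρ0 k) (h k hk) hα hαβ
      exact ⟨E, fun _ => hE⟩
    · exact ⟨∅, fun h => absurd h hk⟩
  choose E hE using hEx
  set F : ℕ → Set Pair := fun k => pairsOf (shell x (ρ k) (ρ (k + 1))) with hF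
  set far : ℕ → Set Pair := fun k => (pairsOf fun u v => u ∈ Ioc (x - 2 * ρ k) (x + 2 * ρ k) ∧
    v ∉ Ioc (x - ρ (k + 1)) (x + ρ (k + 1))) \ {e₀} with hfar
  have hFe₀ : ∀ k < G * q, F k ⊆ {e₀}ᶜ := by
    rintro k hk e he rfl
    have := hyk k hk
    rcases he with ⟨⟨h1, h2⟩, -⟩ | ⟨⟨h1, h2⟩, -⟩ <;> rcases he₀ with h0 | h0 <;>
      rw [h0] at h1 h2 <;> simp_all
  have hfarlaw : ∀ k, law β (NoEdge (far k))ᶜ ≤ ENNReal.ofReal (32 * edgeConst β / M) := by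
    intro k
    have h1 := hρ0 k
    have h2 := hstep k
    have hinc : far k ⊆ incident (Finset.Ioc (x - 2 * ρ k) (x + 2 * ρ k))
        (ρ (k + 1) - 2 * ρ k) := by
      rintro e ⟨he, -⟩
      have hlt := e.2
      unfold incident len
      rcases he with ⟨h3, h4⟩ | ⟨h3, h4⟩ <;>
      · simp only [mem_Ioc, Finset.mem_Ioc, mem_ofPred_eq] at *
        omega
    refine (law_compl_noEdge_le β (by omega) hinc).trans (ENNReal.ofReal_le_ofReal ?_)
    rw [Int.card_Ioc]
    have h3 : (((x + 2 * ρ k - (x - 2 * ρ k)).toNat : ℕ) : ℝ) = 4 * ρ k := by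
      have : ((x + 2 * ρ k - (x - 2 * ρ k)).toNat : ℤ) = 4 * ρ k := by omega
      exact_mod_cast congrArg (Int.cast : ℤ → ℝ) this
    have h4 : (1 : ℝ) ≤ ρ k := by exact_mod_cast h1
    have h5 : (M : ℝ) * ρ k ≤ ρ (k + 1) := by exact_mod_cast hρ k
    have h6 : (4 : ℝ) ≤ M := by exact_mod_cast hM
    have h7 := edgeConst_pos β
    rw [h3]
    push_cast
    have h8 : (M : ℝ) * ρ k ≤ 2 * (ρ (k + 1) - 2 * ρ k) := by nlinarith
    rw [div_le_div_iff₀ (by nlinarith) (by linarith)]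
    calc 4 * (ρ k : ℝ) * (4 * edgeConst β) * M = 16 * edgeConst β * (M * ρ k) := by ring
      _ ≤ 16 * edgeConst β * (2 * (ρ (k + 1) - 2 * ρ k)) := by gcongr
      _ = _ := by ring
  refine ⟨(⋂ k : Fin (G * q), NoEdge (far k)) ∩ ⋂ g : Fin G, ⋃ i : Fin q, E (g * q + i), ?_, ?_, ?_⟩
  · exact (DecreasingOn.iInter fun k => decreasingOn_noEdge fun e he => he.2).inter
      (DecreasingOn.iInter fun g => DecreasingOn.iUnion fun i =>
        (hE _ (hlt g i)).1.mono (hFe₀ _ (hlt g i)))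
  · have hexp : Real.exp (-(64 * β)) ≤ 1 := Real.exp_le_one_iff.2 (by
      have : (0 : ℝ) ≤ β := β.2
      linarith)
    have h6 : (4 : ℝ) ≤ M := by exact_mod_cast hM
    have h7 := edgeConst_pos β
    have h8 : 0 ≤ 1 - Real.exp (-(64 * β)) / 2 := by linarith
    rw [compl_inter, add_comm, ENNReal.ofReal_add (by positivity) (by positivity)]
    refine (measure_union_le _ _).trans (add_le_add ?_ ?_)
    · rw [compl_iInter]
      calc law β (⋃ k : Fin (G * q), (NoEdge (far k))ᶜ)
          ≤ ∑' k : Fin (G * q), law β (NoEdge (far k))ᶜ := measure_iUnion_le _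
        _ = ∑ k : Fin (G * q), law β (NoEdge (far k))ᶜ := tsum_fintype _
        _ ≤ ∑ k : Fin (G * q), ENNReal.ofReal (32 * edgeConst β / M) :=
          Finset.sum_le_sum fun k _ => hfarlaw k
        _ = _ := by
          rw [Finset.sum_const, Finset.card_univ, Fintype.card_fin, nsmul_eq_mul,
            ENNReal.ofReal_mul (by positivity), ← Nat.cast_mul, ENNReal.ofReal_natCast]
    · rw [ENNReal.ofReal_mul (by positivity), ENNReal.ofReal_natCast, ENNReal.ofReal_pow h8]
      refine law_compl_groups_le β G q F E (fun k hk => (hE k hk).1) ?_ fun k hk => (hE k hk).2.1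
      intro i hi j hj
      have hij := hmono (show j + 1 ≤ i from hj)
      rw [Set.disjoint_left]
      have : ∀ u, u ∈ Ioc (x - ρ (j + 1)) (x + ρ (j + 1)) → u ∈ Ioc (x - ρ i) (x + ρ i) := by
        intro u hu
        simp only [mem_Ioc] at *
        omega
      rintro e (⟨-, h2⟩ | ⟨-, h2⟩) (⟨⟨h3, h4⟩, -⟩ | ⟨⟨h3, h4⟩, -⟩)
      · exact h2 ⟨this _ h3, this _ h4⟩
      · exact h2 ⟨this _ h4, this _ h3⟩
      · exact h2 ⟨this _ h4, this _ h3⟩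
      · exact h2 ⟨this _ h3, this _ h4⟩
  · rintro ω ⟨hω1, hω2⟩ g
    obtain ⟨i, hi⟩ := mem_iUnion.1 (mem_iInter.1 hω2 g)
    have hk := hlt g i
    set k := (g : ℕ) * q + i with hkdef
    have hfark := mem_iInter.1 hω1 ⟨k, hk⟩
    simp only at hfark
    obtain ⟨hl, hr, hn⟩ := (hE k hk).2.2 ω hi
    have h1 := hρ0 k
    have h2 := hstep k
    have hyk := hyk k hk
    -- With the far edges closed, `e₀` is the only edge that can leave the ball of the next radius
    -- from here.
    have hadj : ∀ u ∈ Ioc (x - 2 * ρ k) (x + 2 * ρ k), ∀ v, (graph ω).Adj u v →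
        v ∉ Ioc (x - ρ (k + 1)) (x + ρ (k + 1)) → u = x ∧ v = y := by
      intro u hu v huv hv
      obtain ⟨e, he, h3⟩ := exists_pair_of_adj huv
      by_cases hee : e = e₀
      · rw [hee] at h3
        rcases he₀ with h0 | h0 <;> rcases h3 with h3 | h3 <;> rw [h0, Prod.mk.injEq] at h3
        · exact ⟨h3.1.symm, h3.2.symm⟩
        · exfalso
          rw [← h3.2] at hu
          refine hyk ⟨?_, ?_⟩
          · have := hu.1; omega
          · have := hu.2; omega
        · exfalso
          rw [← h3.1] at hu
          refine hyk ⟨?_, ?_⟩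
          · have := hu.1; omega
          · have := hu.2; omega
        · exact ⟨h3.2.symm, h3.1.symm⟩
      · have h4 : e ∈ far k := by
          refine ⟨?_, hee⟩
          rcases h3 with h3 | h3
          · exact Or.inl (by rw [h3]; exact ⟨hu, hv⟩)
          · exact Or.inr (by rw [h3]; exact ⟨hu, hv⟩)
        rw [hfark e h4] at he
        cases he
    have hside : ∀ u ∈ Ioc (x - 2 * ρ k) (x + 2 * ρ k), u ∉ Ioc (x - ρ k) (x + ρ k) →
        ∀ v, (graph ω).Adj u v → shell x (ρ k) (ρ (k + 1)) u v := by
      intro u hu hu' v huv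
      refine ⟨⟨?_, ?_⟩, fun h => hu' h.1⟩
      · simp only [mem_Ioc] at *
        omega
      · by_contra hv
        refine hu' ?_
        rw [(hadj u hu v huv hv).1]
        simp only [mem_Ioc]
        omega
    refine ⟨i, ?_⟩
    change GoodAnnulus ω x y (ρ k) r
    refine ⟨hl.of_adj fun u hu v huv => adj_keep huv (hside u ?_ ?_ v huv),
      hr.of_adj fun u hu v huv => adj_keep huv (hside u ?_ ?_ v huv), ?_, ?_, ?_⟩
    iterate 4
      simp only [mem_Ioc] at hu ⊢
      omega
    · intro u hu v hv huv
      have hu' : u ∈ Ioc (x - 2 * ρ k) (x + 2 * ρ k) := by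
        simp only [mem_Ioc] at *
        omega
      by_cases hv' : v ∈ Ioc (x - ρ (k + 1)) (x + ρ (k + 1))
      · exfalso
        refine not_adj_of_noEdge hn ⟨Or.inl ⟨hu, hv⟩, ⟨?_, hv'⟩, ?_⟩ huv <;>
        · simp only [mem_Ioc] at *
          omega
      · exact hadj u hu' v huv hv'
    · intro u hu v hv huv
      refine not_adj_of_noEdge hn ⟨Or.inr (Or.inl ⟨hu, hv⟩), hside u ?_ ?_ v huv⟩ huv <;>
      · simp only [mem_Ioc] at *
        omega
    · intro u hu v hv huv
      refine not_adj_of_noEdge hn ⟨Or.inr (Or.inr ⟨hu, hv⟩), hside u ?_ ?_ v huv⟩ huv <;>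
      · simp only [mem_Ioc] at *
        omega

end LRP

/-! ### The deterministic doubling dichotomy. -/

namespace LRP

open MeasureTheory ProbabilityTheory Set

/-- The endpoint `x` of the edge `{x, y}` is surrounded by `Q` disjoint good annuli. -/
def Surrounded (ω : Pair → Bool) (a b : ℤ) (Q : ℕ) (r : ℝ) (x y : ℤ) : Prop :=
  ∃ σ : Fin Q → ℤ, (∀ g, 0 < σ g) ∧ (∀ g g', g < g' → 2 * σ g ≤ σ g') ∧
    ∀ g, a ≤ x - 2 * σ g ∧ x + 2 * σ g ≤ b ∧ y ∉ Ioc (x - 2 * σ g) (x + 2 * σ g) ∧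
      GoodAnnulus ω x y (σ g) r

/-- The `2 Q` side blocks of the annuli are disjoint, since the radii at least double, and the
squared fluxes through each pair of side blocks add up to at least `f x y ^ 2 / 2` by `annulus`. -/
theorem Surrounded.energy_ge {ω : Pair → Bool} {a b : ℤ} {Q : ℕ} {r : ℝ} {x y : ℤ} (hr : 0 ≤ r)
    (h : Surrounded ω a b Q r x y) {V : Finset ℤ} {f : ℤ → ℤ → ℝ}
    (hf : IsThroughFlow ω V a b f) : r * (Q * f x y ^ 2) ≤ 4 * windowEnergy V f := by
  obtain ⟨σ, hσ0, hσ, hG⟩ := h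
  set c : Fin Q × Bool → ℤ := fun i => if i.2 then x + σ i.1 else x - 2 * σ i.1 with hc
  set d : Fin Q × Bool → ℤ := fun i => if i.2 then x + 2 * σ i.1 else x - σ i.1 with hd
  have h1 := hf.two_mul_energy_ge Finset.univ c d (r := r) ?_ ?_ ?_
  · rw [Fintype.sum_prod_type] at h1
    have h2 : ∑ g : Fin Q, f x y ^ 2 ≤ 2 * ∑ g : Fin Q, ∑ t : Bool,
        flux V f (Iic (c (g, t))) (Ioc (c (g, t)) (d (g, t))) ^ 2 := by
      rw [Finset.mul_sum]
      refine Finset.sum_le_sum fun g _ => ?_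
      obtain ⟨ha, hb, hy, hgood⟩ := hG g
      have := hf.annulus (hσ0 g) ha hb hy hgood.center hgood.left_right hgood.right_left
      rw [Fintype.sum_bool]
      simp only [hc, hd, if_true, Bool.false_eq_true, if_false]
      linarith
    rw [Finset.sum_const, Finset.card_univ, Fintype.card_fin, nsmul_eq_mul] at h2
    have h3 := mul_le_mul_of_nonneg_left h2 hr
    linarith
  · rintro ⟨g, t⟩ - u hu
    have := hG g
    have := hσ0 g
    cases t <;> simp only [hc, hd, if_true, Bool.false_eq_true, if_false, mem_Ioc] at hu ⊢ <;> omega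
  · rintro ⟨g, t⟩ - ⟨g', t'⟩ - u hu hu'
    have h3 := hσ0 g
    have h4 := hσ0 g'
    have h5 : g = g' := by
      rcases lt_trichotomy g g' with hlt | heq | hlt
      · exfalso
        have := hσ g g' hlt
        cases t <;> cases t' <;>
          simp only [hc, hd, if_true, Bool.false_eq_true, if_false, mem_Ioc] at hu hu' <;> omega
      · exact heq
      · exfalso
        have := hσ g' g hlt
        cases t <;> cases t' <;>
          simp only [hc, hd, if_true, Bool.false_eq_true, if_false, mem_Ioc] at hu hu' <;> omega
    subst h5
    cases t <;> cases t' <;>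
      simp only [hc, hd, if_true, Bool.false_eq_true, if_false, mem_Ioc] at hu hu' ⊢ <;> omega
  · rintro ⟨g, t⟩ -
    cases t
    · simpa [hc, hd] using (hG g).2.2.2.left
    · simpa [hc, hd] using (hG g).2.2.2.right

/-- The dichotomy behind the doubling of the resistance: either the flow crosses many blocks, or
a substantial part of it uses a single long edge and has to cross the annuli around its endpoint. -/
theorem crossing_two_mul {ω : Pair → Bool} {a b ℓ : ℤ} {r : ℝ} (hr : 0 ≤ r) (hℓ : 0 < ℓ)
    (c : Fin 16 → ℤ) (hca : ∀ g, a ≤ c g) (hcb : ∀ g, c g + ℓ ≤ b)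
    (hdisj : ∀ g g' u, u ∈ Ioc (c g) (c g + ℓ) → u ∈ Ioc (c g') (c g' + ℓ) → g = g')
    (hcross : ∀ g, Crossing ω (c g) (c g + ℓ) r) {W Q : ℕ} (hQ : 32 * W ^ 2 ≤ Q)
    (hW : ω ∈ FewEdges (incident (Finset.Ioc a b) ℓ) W)
    (hsurr : ∀ e ∈ incident (Finset.Ioc a b) ℓ, ω e = true →
      ∃ x y, (e.1 = (x, y) ∨ e.1 = (y, x)) ∧ Surrounded ω a b Q r x y) :
    Crossing ω a b (2 * r) := by
  intro V f hf
  set θ := flux V f (Iic a) (Ioc a b) with hθ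
  by_cases hall : ∀ g, θ ^ 2 ≤ 4 * flux V f (Iic (c g)) (Ioc (c g) (c g + ℓ)) ^ 2
  · have h1 := hf.two_mul_energy_ge Finset.univ c (fun g => c g + ℓ) (r := r)
      (fun g _ => Ioc_subset_Ioc (hca g) (hcb g)) (fun g _ g' _ u => hdisj g g' u)
      fun g _ => hcross g
    have h2 : ∑ g : Fin 16, θ ^ 2 ≤ 4 * ∑ g : Fin 16,
        flux V f (Iic (c g)) (Ioc (c g) (c g + ℓ)) ^ 2 := by
      rw [Finset.mul_sum]
      exact Finset.sum_le_sum fun g _ => hall g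
    rw [Finset.sum_const, Finset.card_univ, Fintype.card_fin, nsmul_eq_mul] at h2
    push_cast at h2
    have h3 := mul_le_mul_of_nonneg_left h2 hr
    linarith
  · push Not at hall
    obtain ⟨g, hg⟩ := hall
    have h1 := hf.flux_block_add_jump (hca g) (by omega : c g ≤ c g + ℓ) (hcb g)
    set θ' := flux V f (Iic (c g)) (Ioc (c g) (c g + ℓ))
    -- Less than half of the flux enters this sub-block from the left of it, so at least half jumps
    -- over it.
    have h2 : θ ^ 2 ≤ 4 * flux V f (Iic (c g)) (Ioi (c g + ℓ)) ^ 2 := by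
      have h3 : |2 * θ'| < |θ| := sq_lt_sq.1 (by linarith)
      have h4 : |θ| ≤ |2 * flux V f (Iic (c g)) (Ioi (c g + ℓ))| := by
        have h5 : 2 * flux V f (Iic (c g)) (Ioi (c g + ℓ)) = 2 * θ - 2 * θ' := by linarith
        rw [h5]
        have h6 := abs_sub_abs_le_abs_sub (2 * θ) (2 * θ')
        rw [abs_mul, abs_two] at h6
        linarith
      have := sq_le_sq.2 h4
      linarith
    have h0 : flux V f (Iic (c g)) (Ioi (c g + ℓ)) ≠ 0 := by
      intro h0
      rw [h0] at h2
      nlinarith [sq_nonneg θ']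
    obtain ⟨T, hT, hT'⟩ := hW
    obtain ⟨u, v, hu, hv, hfuv, hle⟩ := hf.exists_jump (by omega : c g ≤ c g + ℓ) T hT
      (fun e he he1 he2 he3 => hT' e ⟨by simpa using he3, by unfold len; omega⟩ he) h0
    obtain ⟨-, hadj, hI⟩ := hf.support u v hfuv
    have huv : u < v := by omega
    have hopen : ω ⟨(u, v), huv⟩ = true := by
      rcases hadj with ⟨_, h⟩ | ⟨h, _⟩
      · exact h
      · omega
    obtain ⟨x, y, hxy, hs⟩ := hsurr ⟨(u, v), huv⟩
      ⟨by simpa using hI, by unfold len; simp only; omega⟩ hopen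
    have hsq : f x y ^ 2 = f u v ^ 2 := by
      rcases hxy with h | h <;> rw [Prod.mk.injEq] at h <;> obtain ⟨rfl, rfl⟩ := h
      · rfl
      · rw [hf.antisymm, neg_sq]
    have h5 := hs.energy_ge hr hf
    rw [hsq] at h5
    have h6 : flux V f (Iic (c g)) (Ioi (c g + ℓ)) ^ 2 ≤ W ^ 2 * f u v ^ 2 := by
      rw [← sq_abs, ← sq_abs (f u v), ← mul_pow]
      exact pow_le_pow_left₀ (abs_nonneg _) hle 2
    have h7 : (32 * (W : ℝ) ^ 2) * f u v ^ 2 ≤ Q * f u v ^ 2 :=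
      mul_le_mul_of_nonneg_right (by exact_mod_cast hQ) (sq_nonneg _)
    -- Here `θ² ≤ 4 W² f²` and `32 W² ≤ Q`, which is why `32` is required.
    have h8 : 8 * θ ^ 2 ≤ Q * f u v ^ 2 := by linarith
    have h9 := mul_le_mul_of_nonneg_left h8 hr
    linarith

end LRP

/-! ### Doubling with high probability. -/

namespace LRP

open MeasureTheory ProbabilityTheory Set

/-- The event attached to an edge ignores the state of that edge, so the expected number of open
edges with a failing event is at most the expected number of open edges times `ε`. -/
theorem law_iUnion_open_inter_le (β : ℝ≥0) {F : Set Pair} {I : Finset ℤ} {D : ℤ} (hD : 1 ≤ D)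
    (hF : F ⊆ incident I D) (A : Pair → Set (Pair → Bool)) {ε : ℝ≥0∞}
    (hA : ∀ e ∈ F, DecreasingOn {e}ᶜ (A e)) (hε : ∀ e ∈ F, law β (A e)ᶜ ≤ ε) :
    law β (⋂ e : F, {ω : Pair → Bool | ω e = false} ∪ A e)ᶜ ≤
      ENNReal.ofReal (I.card * (4 * edgeConst β) / D) * ε := by
  rw [compl_iInter]
  calc law β (⋃ e : F, ({ω : Pair → Bool | ω e = false} ∪ A e)ᶜ)
      ≤ ∑' e : F, law β ({ω : Pair → Bool | ω e = false} ∪ A e)ᶜ := measure_iUnion_le _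
    _ ≤ ∑' e : F, law β {ω : Pair → Bool | ω e = true} * ε := by
      refine ENNReal.tsum_le_tsum fun e => ?_
      have h1 : ({ω : Pair → Bool | ω e = false} ∪ A e)ᶜ =
          {ω : Pair → Bool | ω e ∈ ({true} : Set Bool)} ∩ (A e)ᶜ := by
        ext ω
        simp
      rw [h1, law_inter β (disjoint_compl_right (a := {e.1}))
        (measurableSet_cyl_eval (mem_singleton _) _)
        (@MeasurableSet.compl _ _ (cyl _) (hA e e.2).meas)]
      exact mul_le_mul' le_rfl (hε e e.2)
    _ = (∑' e : F, law β {ω : Pair → Bool | ω e = true}) * ε := ENNReal.tsum_mul_right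
    _ ≤ _ := mul_le_mul' (tsum_incident_le β F I hD hF) le_rfl

/-- The failure probability for an endpoint of a long edge. -/
noncomputable def endpointError (β : ℝ≥0) (Q q : ℕ) (M : ℤ) : ℝ :=
  Q * (1 - Real.exp (-(64 * β)) / 2) ^ q + Q * q * (32 * edgeConst β / M)

theorem endpointError_nonneg (β : ℝ≥0) (Q q : ℕ) {M : ℤ} (hM : 0 ≤ M) :
    0 ≤ endpointError β Q q M := by
  have hexp : Real.exp (-(64 * β)) ≤ 1 := Real.exp_le_one_iff.2 (by
    have : (0 : ℝ) ≤ β := β.2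
    linarith)
  have h6 : (0 : ℝ) ≤ M := by exact_mod_cast hM
  have h7 := edgeConst_pos β
  have h8 : 0 ≤ 1 - Real.exp (-(64 * β)) / 2 := by linarith
  unfold endpointError
  positivity

/-- The terms of `hα'` pay, in order, for a group without a hard sub-block, edges between candidate
sub-blocks, more than `W` long edges, a long edge ending near the boundary of the block, and a long
edge whose endpoint lacks good annuli. -/
theorem robust_two_mul {β : ℝ≥0} {α r : ℝ} (hr : 0 ≤ r) (hα : 0 ≤ α)
    (hαβ : α ≤ Real.exp (-(64 * β)) / 4) {N ℓ δ M : ℤ} {q W Q q' : ℕ} (hℓ : 0 < ℓ)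
    (hδ : ℓ < δ) (hN : 16 * q * δ ≤ N) (hℓN : ℓ ≤ N) (hW : 0 < W) (hQ : 32 * W ^ 2 ≤ Q) (hM : 4 ≤ M)
    (ρ : ℕ → ℤ) (hρ0 : ∀ k, 1 ≤ ρ k) (hρ : ∀ k, M * ρ k ≤ ρ (k + 1))
    (hρℓ : 2 * ρ (Q * q') ≤ ℓ) (hrob : Robust β α ℓ r)
    (hrob' : ∀ k < Q * q', Robust β α (ρ k) r) {α' : ℝ}
    (hα' : 16 * α ^ q + 16 * q * ℓ * (4 * edgeConst β) / (δ - ℓ) + N * (4 * edgeConst β) / ℓ / W +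
      2 * ρ (Q * q') * (4 * edgeConst β) / ℓ +
      N * (4 * edgeConst β) / ℓ * endpointError β Q q' M ≤ α') :
    Robust β α' N (2 * r) := by
  classical
  intro a
  set σ := ρ (Q * q') with hσ
  have hσ0 : 1 ≤ σ := hρ0 _
  have hstep : ∀ k, 4 * ρ k ≤ ρ (k + 1) := fun k => by
    have := hρ k
    have := hρ0 k
    nlinarith
  have hmono : Monotone ρ := monotone_nat_of_le_succ fun k => by
    have := hstep k
    have := hρ0 k
    omega
  have hδ0 : 0 < δ := hℓ.trans hδ
  -- the blocks
  obtain ⟨S₁, hS₁, hlaw₁, hω₁⟩ := exists_hard_blocks hα hℓ (by omega : 1 ≤ δ - ℓ) hrob 16 q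
    (fun i => a + i * δ) (by
      intro i j hij
      have : ((i : ℤ) + 1) * δ ≤ j * δ :=
        mul_le_mul_of_nonneg_right (by exact_mod_cast hij) hδ0.le
      linarith)
  -- the long edges
  set I := Finset.Ioc a (a + N) with hI
  -- Once no long edge ends within `σ` of the boundary, all annuli around an endpoint inside the
  -- block fit into it.
  set J := Finset.Ioc a (a + σ) ∪ Finset.Ioc (a + N - σ) (a + N) with hJ
  have hcardI : (I.card : ℝ) = N := by
    rw [hI, Int.card_Ioc]
    have : ((a + N - a).toNat : ℤ) = N := by omega
    exact_mod_cast congrArg (Int.cast : ℤ → ℝ) this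
  have hcardJ : (J.card : ℝ) ≤ 2 * σ := by
    have h1 : J.card ≤ _ := Finset.card_union_le _ _
    rw [Int.card_Ioc, Int.card_Ioc] at h1
    have : (J.card : ℤ) ≤ 2 * σ := by omega
    exact_mod_cast this
  set X : Pair → ℤ := fun e => if e.1.1 ∈ I then e.1.1 else e.1.2 with hX
  set Y : Pair → ℤ := fun e => if e.1.1 ∈ I then e.1.2 else e.1.1 with hY
  have hXY : ∀ e : Pair, e.1 = (X e, Y e) ∨ e.1 = (Y e, X e) := by
    intro e
    simp only [hX, hY]
    split_ifs
    · exact Or.inl rfl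
    · exact Or.inr rfl
  have hXI : ∀ e ∈ incident I ℓ, X e ∈ I := by
    rintro e ⟨he, -⟩
    simp only [hX]
    split_ifs with h
    · exact h
    · exact he.resolve_left h
  -- A long edge has length at least `ℓ ≥ 2 σ`, so its other endpoint lies outside every annulus
  -- used.
  have hdist : ∀ e ∈ incident I ℓ, Y e ∉ Ioc (X e - σ) (X e + σ) := by
    rintro e ⟨-, he⟩
    unfold len at he
    rcases hXY e with h | h <;> rw [h] at he <;> simp only [mem_Ioc] at * <;> omega
  set F : Set Pair := {e | e ∈ incident I ℓ ∧ X e ∉ J} with hF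
  have hFinc : F ⊆ incident I ℓ := fun e he => he.1
  have hEx : ∀ e, ∃ A, e ∈ F → DecreasingOn {e}ᶜ A ∧
      law β Aᶜ ≤ ENNReal.ofReal (endpointError β Q q' M) ∧
      ∀ ω ∈ A, ∀ g : Fin Q, ∃ i : Fin q', GoodAnnulus ω (X e) (Y e) (ρ (g * q' + i)) r := by
    intro e
    by_cases he : e ∈ F
    · obtain ⟨A, hA⟩ := exists_good_annuli hα hαβ Q q' e (hXY e) hM ρ hρ0 hρ hrob' (hdist e he.1)
      exact ⟨A, fun _ => hA⟩
    · exact ⟨∅, fun h => absurd h he⟩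
  choose A hA using hEx
  refine ⟨S₁ ∩ FewEdges (incident I ℓ) W ∩ NoEdge (incident J ℓ) ∩
    ⋂ e : F, {ω : Pair → Bool | ω e = false} ∪ A e, ?_, ?_, ?_⟩
  · refine ((hS₁.inter (decreasingOn_fewEdges (subset_univ _) W)).inter
      (decreasingOn_noEdge (subset_univ _))).inter (DecreasingOn.iInter fun e => ?_)
    exact (DecreasingOn.closed (mem_univ _)).union ((hA e e.2).1.mono (subset_univ _))
  · have hC := edgeConst_pos β
    have hℓ' : (0 : ℝ) < ℓ := by exact_mod_cast hℓ
    have hN' : (0 : ℝ) ≤ N := by exact_mod_cast (hℓ.le.trans hℓN)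
    have hδ' : (0 : ℝ) < δ - ℓ := by exact_mod_cast (by omega : 0 < δ - ℓ)
    have hσ' : (0 : ℝ) ≤ σ := by exact_mod_cast (by omega : 0 ≤ σ)
    have hε := endpointError_nonneg β Q q' (by omega : 0 ≤ M)
    have h2 := law_compl_fewEdges_le β (by omega : 1 ≤ ℓ) (subset_refl (incident I ℓ)) hW
    have h3 := law_compl_noEdge_le β (by omega : 1 ≤ ℓ) (subset_refl (incident J ℓ))
    have h4 := law_iUnion_open_inter_le β (by omega : 1 ≤ ℓ) hFinc A (fun e he => (hA e he).1)
      fun e he => (hA e he).2.1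
    rw [hcardI] at h2 h4
    rw [← ENNReal.ofReal_mul (by positivity)] at h4
    have h3' := h3.trans (ENNReal.ofReal_le_ofReal
      (show (J.card : ℝ) * (4 * edgeConst β) / ℓ ≤ 2 * σ * (4 * edgeConst β) / ℓ by gcongr))
    push_cast at hlaw₁
    refine le_trans ?_ (ENNReal.ofReal_le_ofReal hα')
    rw [ENNReal.ofReal_add (by positivity) (by positivity),
      ENNReal.ofReal_add (by positivity) (by positivity),
      ENNReal.ofReal_add (by positivity) (by positivity), compl_inter, compl_inter, compl_inter]
    exact (measure_union_le _ _).trans (add_le_add ((measure_union_le _ _).trans (add_le_add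
      ((measure_union_le _ _).trans (add_le_add hlaw₁ h2)) h3')) h4)
  · rintro ω ⟨⟨⟨h1, h2⟩, h3⟩, h4⟩
    choose i hi using hω₁ ω h1
    have hlt : ∀ g : Fin 16, ((g : ℕ) * q + i g : ℤ) + 1 ≤ 16 * q := fun g => by
      have h5 : ((g : ℕ) + 1) * q ≤ 16 * q := Nat.mul_le_mul_right q g.2
      rw [add_mul, one_mul] at h5
      have h6 := (i g).2
      have h7 : (g : ℕ) * q + i g + 1 ≤ 16 * q := by omega
      exact_mod_cast h7
    refine crossing_two_mul hr hℓ (fun g => a + ((g * q + i g : ℕ) : ℤ) * δ) (fun g => ?_)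
      (fun g => ?_) (fun g g' u hu hu' => ?_) hi hQ h2 fun e he hopen => ?_
    · have : 0 ≤ ((g * q + i g : ℕ) : ℤ) * δ := by positivity
      linarith
    · have := mul_le_mul_of_nonneg_right (hlt g) hδ0.le
      push_cast
      nlinarith
    · have key : ∀ k k' : ℤ, k < k' → u ∈ Ioc (a + k * δ) (a + k * δ + ℓ) →
          u ∈ Ioc (a + k' * δ) (a + k' * δ + ℓ) → False := by
        intro k k' hk hu hu'
        have h5 : (k + 1) * δ ≤ k' * δ := mul_le_mul_of_nonneg_right hk hδ0.le
        have h6 := hu.2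
        have h7 := hu'.1
        linarith
      have h5 : (g * q + i g : ℕ) = g' * q + i g' := by
        rcases lt_trichotomy (g * q + i g : ℕ) (g' * q + i g') with h | h | h
        · exact (key _ _ (by exact_mod_cast h) hu hu').elim
        · exact h
        · exact (key _ _ (by exact_mod_cast h) hu' hu).elim
      have hq : 0 < q := lt_of_le_of_lt (Nat.zero_le _) (i g).2
      have h6 := congrArg (· / q) h5
      simp only [Nat.add_div_of_dvd_right (dvd_mul_left q _), Nat.mul_div_cancel _ hq,
        Nat.div_eq_of_lt (i g).2, Nat.div_eq_of_lt (i g').2, add_zero] at h6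
      exact Fin.ext h6
    · refine ⟨X e, Y e, hXY e, ?_⟩
      have hXJ : X e ∉ J := by
        intro hXJ
        have h5 : e ∈ incident J ℓ := by
          refine ⟨?_, he.2⟩
          rcases hXY e with h | h
          · exact Or.inl (by rw [h]; exact hXJ)
          · exact Or.inr (by rw [h]; exact hXJ)
        rw [h3 e h5] at hopen
        cases hopen
      have heF : e ∈ F := ⟨he, hXJ⟩
      have h5 := mem_iInter.1 h4 ⟨e, heF⟩
      have h6 : ω ∈ A e := by
        rcases h5 with h5 | h5
        · rw [mem_ofPred_eq] at h5
          rw [h5] at hopen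
          cases hopen
        · exact h5
      choose k hk using (hA e heF).2.2 ω h6
      have hle : ∀ g g' : Fin Q, g < g' → (g : ℕ) * q' + k g + 1 ≤ g' * q' + k g' := by
        intro g g' hg
        have h7 : ((g : ℕ) + 1) * q' ≤ g' * q' := Nat.mul_le_mul_right q' hg
        rw [add_mul, one_mul] at h7
        have := (k g).2
        omega
      have hle' : ∀ g : Fin Q, (g : ℕ) * q' + k g + 1 ≤ Q * q' := by
        intro g
        have h7 : ((g : ℕ) + 1) * q' ≤ Q * q' := Nat.mul_le_mul_right q' g.2
        rw [add_mul, one_mul] at h7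
        have := (k g).2
        omega
      refine ⟨fun g => ρ (g * q' + k g), fun g => hρ0 _, fun g g' hg => ?_, fun g => ?_⟩
      · have h7 := hmono (hle g g' hg)
        have h8 := hstep (g * q' + k g)
        have h9 := hρ0 (g * q' + k g)
        simp only
        omega
      · have h7 := hmono (hle' g)
        have h8 := hstep (g * q' + k g)
        have h9 := hρ0 (g * q' + k g)
        have h10 := hXI e he
        have h11 := hdist e he
        rw [← hσ] at h7
        simp only [hI, hJ, Finset.mem_union, Finset.mem_Ioc, mem_Ioc] at h10 h11 hXJ
        refine ⟨?_, ?_, ?_, hk g⟩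
        · simp only; omega
        · simp only; omega
        · simp only [mem_Ioc]; omega

end LRP

/-! ### Choice of parameters and induction over dyadic scales. -/

namespace LRP

open MeasureTheory ProbabilityTheory Set

theorem Robust.mono {β : ℝ≥0} {α r r' : ℝ} {ℓ : ℤ} (h : Robust β α ℓ r) (hr : r' ≤ r) :
    Robust β α ℓ r' := fun a => by
  obtain ⟨S, h1, h2, h3⟩ := h a
  exact ⟨S, h1, h2, fun ω hω => (h3 ω hω).mono hr⟩

/-- The base of the induction: the number of edges incident to the block is bounded with high
probability. -/
theorem exists_robust (β : ℝ≥0) {α : ℝ} (hα : 0 < α) {ℓ : ℤ} (hℓ : 0 < ℓ) :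
    ∃ r, 0 < r ∧ Robust β α ℓ r := by
  have hC := edgeConst_pos β
  have hℓ' : (0 : ℝ) < ℓ := by exact_mod_cast hℓ
  obtain ⟨W, hW⟩ := exists_nat_gt (ℓ * (4 * edgeConst β) / α)
  have hW0 : (0 : ℝ) < W := lt_of_le_of_lt (by positivity) hW
  have hW1 : 0 < W := by exact_mod_cast hW0
  refine ⟨1 / (2 * W), by positivity, fun a => ⟨FewEdges (incident (Finset.Ioc a (a + ℓ)) 1) W,
    decreasingOn_fewEdges (subset_univ _) W, ?_, ?_⟩⟩
  · refine (law_compl_fewEdges_le β le_rfl subset_rfl hW1).trans (ENNReal.ofReal_le_ofReal ?_)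
    rw [Int.card_Ioc]
    have h1 : (((a + ℓ - a).toNat : ℕ) : ℝ) = ℓ := by
      have : ((a + ℓ - a).toNat : ℤ) = ℓ := by omega
      exact_mod_cast congrArg (Int.cast : ℤ → ℝ) this
    rw [h1, Int.cast_one, div_one, div_le_iff₀ hW0, mul_comm α]
    exact ((div_lt_iff₀ hα).1 hW).le
  · rintro ω ⟨T, hT, hT'⟩
    refine crossing_of_card_le hW1 T hT fun e he hI => hT' e ⟨by simpa using hI, ?_⟩ he
    exact len_pos e

theorem exists_mul_half_pow_le (K : ℝ) {η : ℝ} (hK : 0 ≤ K) (hη : 0 < η) (k₀ : ℕ) :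
    ∃ k, k₀ ≤ k ∧ K * (1 / 2) ^ k ≤ η := by
  obtain ⟨k, hk⟩ := exists_pow_lt_of_lt_one (show 0 < η / (K + 1) by positivity)
    (by norm_num : (1 / 2 : ℝ) < 1)
  refine ⟨k₀ + k, by omega, ?_⟩
  have h1 : (1 / 2 : ℝ) ^ (k₀ + k) ≤ (1 / 2) ^ k :=
    pow_le_pow_of_le_one (by norm_num) (by norm_num) (by omega)
  calc K * (1 / 2) ^ (k₀ + k) ≤ (K + 1) * (η / (K + 1)) :=
        mul_le_mul (by linarith) (h1.trans hk.le) (by positivity) (by positivity)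
    _ = η := by field_simp

theorem exists_endpointError_le (β : ℝ≥0) (Q : ℕ) {ε : ℝ} (hε : 0 < ε) :
    ∃ q L : ℕ, 2 ≤ L ∧ endpointError β Q q (2 ^ L) ≤ ε := by
  have hC := edgeConst_pos β
  have hexp : Real.exp (-(64 * β)) ≤ 1 := Real.exp_le_one_iff.2 (by
    have : (0 : ℝ) ≤ β := β.2
    linarith)
  have hexp' := Real.exp_pos (-(64 * β))
  obtain ⟨q, hq⟩ := exists_pow_lt_of_lt_one (show 0 < ε / 2 / (Q + 1) by positivity)
    (show 1 - Real.exp (-(64 * β)) / 2 < 1 by linarith)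
  obtain ⟨L, hL, hL'⟩ := exists_mul_half_pow_le (Q * q * (32 * edgeConst β)) (by positivity)
    (half_pos hε) 2
  refine ⟨q, L, hL, ?_⟩
  unfold endpointError
  have h1 : (Q : ℝ) * (1 - Real.exp (-(64 * β)) / 2) ^ q ≤ ε / 2 := by
    have h2 : 0 ≤ (1 - Real.exp (-(64 * β)) / 2) ^ q := pow_nonneg (by linarith) q
    calc (Q : ℝ) * (1 - Real.exp (-(64 * β)) / 2) ^ q ≤ (Q + 1) * (ε / 2 / (Q + 1)) :=
          mul_le_mul (by linarith) hq.le h2 (by positivity)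
      _ = ε / 2 := by field_simp
  have h3 : (Q : ℝ) * q * (32 * edgeConst β / ((2 ^ L : ℤ) : ℝ)) ≤ ε / 2 := by
    refine le_trans (le_of_eq ?_) hL'
    push_cast
    rw [one_div, inv_pow]
    ring
  linarith

/-- The choices are not circular: `q` and the spacing `t` fix the ratio `N / ℓ = 2 ^ m`, this ratio
fixes `W` and hence `Q`, and only then are the number of trials `q'` and the scale ratio `2 ^ L`
chosen. None depends on `n`. The five errors receive `α / 8`, `α / 8` and three times `α / 4`. -/
theorem robust_doubling (β : ℝ≥0) {α : ℝ} (hα : 0 < α) (hαβ : α ≤ Real.exp (-(64 * β)) / 4) :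
    ∃ T : ℕ, 1 ≤ T ∧ ∀ n, T ≤ n → ∀ r, 0 ≤ r →
      (∀ k, k < n → n ≤ k + T → Robust β α (2 ^ k) r) → Robust β α (2 ^ n) (2 * r) := by
  have hC := edgeConst_pos β
  have hexp : Real.exp (-(64 * β)) ≤ 1 := Real.exp_le_one_iff.2 (by
    have : (0 : ℝ) ≤ β := β.2
    linarith)
  obtain ⟨q, hq⟩ := exists_pow_lt_of_lt_one (show 0 < α / 8 / 16 by positivity)
    (show α < 1 by linarith)
  have hκ : 16 * q ≤ 2 ^ (16 * q) := Nat.lt_two_pow_self.le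
  obtain ⟨t, -, ht⟩ := exists_mul_half_pow_le (16 * q * (4 * edgeConst β)) (by positivity)
    (show 0 < α / 8 by positivity) 0
  -- The spacing is `δ = 2 ^ (1 + t) * ℓ`, and `16 q ≤ 2 ^ (16 q)` is a crude way to fit the `16 q`
  -- candidates at this spacing into `2 ^ m * ℓ`.
  set m := 16 * q + (1 + t) with hm
  obtain ⟨W, hW⟩ := exists_nat_gt (2 ^ m * (4 * edgeConst β) / (α / 4))
  have hW0 : (0 : ℝ) < W := lt_of_le_of_lt (by positivity) hW
  obtain ⟨s, hs, hs'⟩ := exists_mul_half_pow_le (2 * (4 * edgeConst β)) (by positivity)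
    (show 0 < α / 4 by positivity) 1
  set Q := 32 * W ^ 2 with hQ
  obtain ⟨q', L, hL, hε⟩ := exists_endpointError_le β Q
    (show 0 < α / 4 / (2 ^ m * (4 * edgeConst β)) by positivity)
  have hm1 : 1 ≤ m := by omega
  refine ⟨m + s + L * (Q * q'), by omega, fun n hn r hr hrob => ?_⟩
  obtain ⟨b, rfl⟩ := Nat.exists_eq_add_of_le' hn
  -- The radii start at `2 ^ b` with `b = n - T`, so every scale used lies in the window of the last
  -- `T` exponents.
  set ρ : ℕ → ℤ := fun k => 2 ^ (b + L * k) with hρ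
  have hσ0 : (0 : ℝ) < ρ (Q * q') := by
    simp only [hρ]; positivity
  have hℓ : (2 : ℤ) ^ (b + L * (Q * q') + s) = 2 ^ s * ρ (Q * q') := by
    simp only [hρ]; ring
  have hδ : (2 : ℤ) ^ (b + L * (Q * q') + s + (1 + t)) = 2 ^ (1 + t) * (2 ^ s * ρ (Q * q')) := by
    simp only [hρ]; ring
  have hN : (2 : ℤ) ^ (b + (m + s + L * (Q * q'))) = 2 ^ m * (2 ^ s * ρ (Q * q')) := by
    simp only [hρ]; ring
  refine robust_two_mul hr hα.le hαβ (ℓ := 2 ^ (b + L * (Q * q') + s))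
    (δ := 2 ^ (b + L * (Q * q') + s + (1 + t))) (M := 2 ^ L) (q := q) (W := W) (Q := Q) (q' := q')
    (by positivity) (pow_lt_pow_right₀ (by norm_num) (by omega)) ?_
    (pow_le_pow_right₀ (by norm_num) (by omega)) (by exact_mod_cast hW0) hQ.ge ?_ ρ (fun k => ?_)
    (fun k => ?_) ?_ (hrob _ (by omega) (by omega)) (fun k hk => hrob _ ?_ ?_) ?_
  · have h1 : (16 * q : ℤ) ≤ 2 ^ (16 * q) := by exact_mod_cast hκ
    calc (16 * q : ℤ) * 2 ^ (b + L * (Q * q') + s + (1 + t))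
        ≤ 2 ^ (16 * q) * 2 ^ (b + L * (Q * q') + s + (1 + t)) := by gcongr
      _ = 2 ^ (b + (m + s + L * (Q * q'))) := by
        rw [← pow_add]
        congr 1
        omega
  · calc (4 : ℤ) = 2 ^ 2 := by norm_num
      _ ≤ 2 ^ L := pow_le_pow_right₀ (by norm_num) hL
  · exact one_le_pow₀ (by norm_num)
  · simp only [hρ]
    rw [← pow_add]
    exact pow_le_pow_right₀ (by norm_num) (by rw [mul_add]; omega)
  · simp only [hρ]
    rw [← pow_succ']
    exact pow_le_pow_right₀ (by norm_num) (by omega)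
  · have := Nat.mul_le_mul_left L hk.le
    omega
  · omega
  · rw [hℓ, hδ, hN]
    push_cast
    set σ : ℝ := (ρ (Q * q') : ℝ) with hσ
    have p1 : (0 : ℝ) < 2 ^ s * σ := by positivity
    have t1 : 16 * α ^ q ≤ α / 8 := by linarith
    have t2 : 16 * q * (2 ^ s * σ) * (4 * edgeConst β) / (2 ^ (1 + t) * (2 ^ s * σ) - 2 ^ s * σ) ≤
        α / 8 := by
      refine le_trans ?_ ht
      have h1 : (2 : ℝ) ^ t * (2 ^ s * σ) ≤ 2 ^ (1 + t) * (2 ^ s * σ) - 2 ^ s * σ := by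
        have h2 : (1 : ℝ) ≤ 2 ^ t := one_le_pow₀ (by norm_num)
        rw [pow_add, pow_one]
        nlinarith
      calc _ ≤ 16 * q * (2 ^ s * σ) * (4 * edgeConst β) / (2 ^ t * (2 ^ s * σ)) := by gcongr
        _ = 16 * q * (4 * edgeConst β) * (1 / 2) ^ t := by
          rw [one_div, inv_pow]
          field_simp
    have t3 : 2 ^ m * (2 ^ s * σ) * (4 * edgeConst β) / (2 ^ s * σ) / W ≤ α / 4 := by
      have h1 : 2 ^ m * (2 ^ s * σ) * (4 * edgeConst β) / (2 ^ s * σ) =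
        2 ^ m * (4 * edgeConst β) := by field_simp
      rw [h1, div_le_iff₀ hW0, mul_comm (α / 4)]
      exact ((div_lt_iff₀ (by positivity)).1 hW).le
    have t4 : 2 * σ * (4 * edgeConst β) / (2 ^ s * σ) ≤ α / 4 := by
      refine le_trans (le_of_eq ?_) hs'
      rw [one_div, inv_pow]
      field_simp
    have t5 : 2 ^ m * (2 ^ s * σ) * (4 * edgeConst β) / (2 ^ s * σ) *
        endpointError β Q q' (2 ^ L) ≤ α / 4 := by
      have h1 : 2 ^ m * (2 ^ s * σ) * (4 * edgeConst β) / (2 ^ s * σ) =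
        2 ^ m * (4 * edgeConst β) := by field_simp
      rw [h1, mul_comm]
      exact (le_div_iff₀ (by positivity)).1 hε
    linarith

/-- The crossing resistances grow exponentially with the scale. -/
theorem exists_robust_pow (β : ℝ≥0) {α : ℝ} (hα : 0 < α) (hαβ : α ≤ Real.exp (-(64 * β)) / 4) :
    ∃ c, 0 < c ∧ ∃ T : ℕ, 1 ≤ T ∧ ∀ n : ℕ, Robust β α (2 ^ n) (c * 2 ^ (n / T)) := by
  obtain ⟨T, hT, hdouble⟩ := robust_doubling β hα hαβ
  have hbase : ∀ m : ℕ, ∃ c, 0 < c ∧ ∀ n < m, Robust β α (2 ^ n) c := by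
    intro m
    induction m with
    | zero => exact ⟨1, one_pos, fun n hn => absurd hn (Nat.not_lt_zero n)⟩
    | succ m ih =>
      obtain ⟨c, hc, h⟩ := ih
      obtain ⟨r, hr, h'⟩ := exists_robust β hα (show (0 : ℤ) < 2 ^ m by positivity)
      refine ⟨min c r, lt_min hc hr, fun n hn => ?_⟩
      rcases Nat.lt_succ_iff_lt_or_eq.1 hn with hn | rfl
      · exact (h n hn).mono (min_le_left _ _)
      · exact h'.mono (min_le_right _ _)
  obtain ⟨c, hc, hsmall⟩ := hbase T
  refine ⟨c, hc, T, hT, fun n => ?_⟩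
  induction n using Nat.strong_induction_on with
  | _ n ih =>
    rcases lt_or_ge n T with hn | hn
    · rw [Nat.div_eq_of_lt hn, pow_zero, mul_one]
      exact hsmall n hn
    · have hdiv : n / T = (n - T) / T + 1 := by
        rw [Nat.div_eq_sub_div hT hn]
      have h1 := hdouble n hn (c * 2 ^ ((n - T) / T)) (by positivity) fun k hk hk' => by
        refine (ih k hk).mono ?_
        have : (n - T) / T ≤ k / T := Nat.div_le_div_right (by omega)
        gcongr
        norm_num
      rw [hdiv, pow_succ]
      convert h1 using 1
      ring

/-! ### The effective resistance -/

/-- Cut an admissible unit flow down to the edges incident to the block. Direct edges across carry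
nothing, so the flux is still one, and the energy does not grow. The finite set `T` turns the
infinite sums for the amount and the net flows into finite ones. -/
theorem ofReal_le_Rhat {ω : Pair → Bool} {n : ℕ} {r : ℝ} (h : Crossing ω 0 (2 ^ n) r)
    (T : Finset Pair) (hT : ∀ e : Pair, ω e = true →
      (e.1.1 ∈ Ioc (0 : ℤ) (2 ^ n) ∨ e.1.2 ∈ Ioc (0 : ℤ) (2 ^ n)) → e ∈ T) :
    ENNReal.ofReal r ≤ Rhat (graph ω) n := by
  classical
  refine le_iInf₂ fun f hf => ?_
  obtain ⟨⟨⟨hanti, hzero⟩, hamount, hcons⟩, hAB⟩ := hf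
  have hanti' : ∀ u v, f u v = -f v u := fun u v => by
    by_cases h : (graph ω).Adj u v
    · exact hanti u v h
    · rw [hzero u v h, hzero v u fun h' => h h'.symm, neg_zero]
  set N : ℤ := 2 ^ n with hN
  set V : Finset ℤ := T.image (fun e => e.1.1) ∪ T.image (fun e => e.1.2) with hV
  set g : ℤ → ℤ → ℝ := fun u v => if u ∈ Ioc 0 N ∨ v ∈ Ioc 0 N then f u v else 0 with hg
  have hg0 : ∀ u v, g u v ≠ 0 → (u ∈ V ∧ v ∈ V) ∧ (graph ω).Adj u v ∧
      (u ∈ Ioc 0 N ∨ v ∈ Ioc 0 N) ∧ g u v = f u v := by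
    intro u v huv
    have hI : u ∈ Ioc 0 N ∨ v ∈ Ioc 0 N := by
      by_contra hI
      exact huv (if_neg hI)
    have hgf : g u v = f u v := if_pos hI
    have hadj : (graph ω).Adj u v := by
      by_contra hadj
      exact huv (hgf.trans (hzero u v hadj))
    refine ⟨?_, hadj, hI, hgf⟩
    obtain ⟨e, he, h1⟩ := exists_pair_of_adj hadj
    have h2 : e ∈ T := by
      refine hT e he ?_
      rcases h1 with h1 | h1 <;> rw [h1]
      · exact hI
      · exact hI.symm
    have h3 : e.1.1 ∈ V := Finset.mem_union_left _ (Finset.mem_image_of_mem _ h2)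
    have h4 : e.1.2 ∈ V := Finset.mem_union_right _ (Finset.mem_image_of_mem _ h2)
    rcases h1 with h1 | h1 <;> rw [h1] at h3 h4
    · exact ⟨h3, h4⟩
    · exact ⟨h4, h3⟩
  have hflow : IsThroughFlow ω V 0 N g := by
    refine ⟨fun u v => ?_, fun u v huv => ?_, fun u hu => ?_⟩
    · simp only [hg]
      by_cases h : u ∈ Ioc 0 N ∨ v ∈ Ioc 0 N
      · rw [if_pos h, if_pos h.symm, hanti' u v]
      · rw [if_neg h, if_neg fun h' => h (Or.symm h'), neg_zero]
    · obtain ⟨h1, h2, h3, -⟩ := hg0 u v huv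
      exact ⟨h1.1, h2, h3⟩
    · have h1 := hcons u (by
        simp only [mem_union, mem_Iic, mem_Ioi, mem_Ioc] at *
        omega)
      rw [← h1, netFlow, tsum_eq_sum (s := V)]
      · exact Finset.sum_congr rfl fun v _ => if_pos (Or.inl hu)
      · intro v hv
        by_contra h2
        refine hv (hg0 u v ?_).1.2
        rwa [show g u v = f u v from if_pos (Or.inl hu)]
  have hflux : flux V g (Iic 0) (Ioc 0 N) = 1 := by
    rw [← hamount, amount, tsum_subtype (Iic (0 : ℤ)) fun i => ∑' j : ↥(Iic (0 : ℤ))ᶜ, f i j]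
    have hin : ∀ i, ∑' j : ↥(Iic (0 : ℤ))ᶜ, f i j = ∑' j, (Iic (0 : ℤ))ᶜ.indicator (f i) j :=
      fun i => tsum_subtype (Iic (0 : ℤ))ᶜ (f i)
    have hpt : ∀ i ∈ Iic (0 : ℤ), ∀ j, (Iic (0 : ℤ))ᶜ.indicator (f i) j =
        if i ∈ Iic (0 : ℤ) ∧ j ∈ Ioc 0 N then g i j else 0 := by
      intro i hi j
      by_cases hj : j ∈ Iic (0 : ℤ)
      · rw [indicator_of_notMem (fun h : j ∈ (Iic (0 : ℤ))ᶜ => h hj), if_neg]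
        rintro ⟨-, h⟩
        exact absurd h.1 (not_lt.2 hj)
      · rw [indicator_of_mem hj]
        by_cases hjN : j ∈ Ioc 0 N
        · rw [if_pos ⟨hi, hjN⟩]
          exact (if_pos (Or.inr hjN)).symm
        · rw [if_neg fun h => hjN h.2]
          by_cases hadj : (graph ω).Adj i j
          · refine hAB i j hi ?_ hadj
            simp only [mem_Iic, mem_Ioc, mem_Ioi] at *
            omega
          · exact hzero i j hadj
    have hrow : ∀ i, (Iic (0 : ℤ)).indicator (fun i => ∑' j : ↥(Iic (0 : ℤ))ᶜ, f i j) i =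
        ∑ j ∈ V, if i ∈ Iic (0 : ℤ) ∧ j ∈ Ioc 0 N then g i j else 0 := by
      intro i
      by_cases hi : i ∈ Iic (0 : ℤ)
      · rw [indicator_of_mem hi, hin, tsum_congr (hpt i hi), tsum_eq_sum]
        intro j hj
        by_contra h2
        refine hj (hg0 i j fun h3 => h2 ?_).1.2
        rw [h3, ite_self]
      · rw [indicator_of_notMem hi]
        exact (Finset.sum_eq_zero fun j _ => if_neg fun h => hi h.1).symm
    rw [tsum_congr hrow, tsum_eq_sum (s := V)]
    · unfold flux
      rw [Finset.sum_product]
      refine Finset.sum_congr rfl fun i _ => Finset.sum_congr rfl fun j _ => ?_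
      congr
    · intro i hi
      refine Finset.sum_eq_zero fun j _ => ?_
      by_contra h2
      refine hi (hg0 i j fun h3 => h2 ?_).1.1
      rw [h3, ite_self]
  have h1 := h V g hflow
  rw [hflux, one_pow, mul_one] at h1
  refine (ENNReal.ofReal_le_ofReal h1).trans ?_
  rw [windowEnergy, energy, ENNReal.ofReal_mul (by norm_num),
    ENNReal.ofReal_sum_of_nonneg fun _ _ => sq_nonneg _]
  refine mul_le_mul' (le_of_eq ?_) ?_
  · rw [ENNReal.ofReal_div_of_pos two_pos, ENNReal.ofReal_one, ENNReal.ofReal_ofNat]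
  · have h2 := tsum_subtype {p : ℤ × ℤ | (graph ω).Adj p.1 p.2}
      fun p => ENNReal.ofReal (f p.1 p.2 ^ 2)
    refine le_trans ?_ h2.ge
    refine le_trans (Finset.sum_le_sum fun p _ => ?_) (ENNReal.sum_le_tsum (V ×ˢ V))
    by_cases hp : g p.1 p.2 = 0
    · rw [hp]; simp
    · obtain ⟨-, h3, -, h4⟩ := hg0 _ _ hp
      rw [h4, indicator_of_mem (show p ∈ {p : ℤ × ℤ | (graph ω).Adj p.1 p.2} from h3)]

/-- The flow along the nearest-neighbour edges from `0` to `N + 1`. -/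
noncomputable def pathFlow (N : ℤ) (i j : ℤ) : ℝ :=
  if 0 ≤ i ∧ i ≤ N ∧ j = i + 1 then 1 else if 0 ≤ j ∧ j ≤ N ∧ i = j + 1 then -1 else 0

theorem pathFlow_antisymm (N i j : ℤ) : pathFlow N i j = -pathFlow N j i := by
  unfold pathFlow
  split_ifs <;> first | omega | norm_num

theorem exists_Rhat_le (n : ℕ) : ∃ K : ℝ≥0∞, K ≠ ⊤ ∧ ∀ ω : Pair → Bool,
    (∀ e : Pair, e.1.2 = e.1.1 + 1 → ω e = true) → Rhat (graph ω) n ≤ K := by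
  classical
  set N : ℤ := 2 ^ n with hN
  have hN1 : 1 ≤ N := one_le_pow₀ (by norm_num)
  refine ⟨1 / 2 * ∑' p : ℤ × ℤ, ENNReal.ofReal (pathFlow N p.1 p.2 ^ 2), ?_, fun ω hω => ?_⟩
  · refine ENNReal.mul_ne_top (by simp) ?_
    rw [tsum_eq_sum (s := Finset.Icc 0 (N + 1) ×ˢ Finset.Icc 0 (N + 1))]
    · exact ENNReal.sum_ne_top.2 fun _ _ => ENNReal.ofReal_ne_top
    · rintro ⟨i, j⟩ hij
      have : pathFlow N i j = 0 := by
        simp only [Finset.mem_product, Finset.mem_Icc] at hij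
        unfold pathFlow
        rw [if_neg (by omega), if_neg (by omega)]
      simp [this]
  · have hadj : ∀ i, (graph ω).Adj i (i + 1) := fun i =>
      Or.inl ⟨by omega, hω ⟨(i, i + 1), by simp⟩ rfl⟩
    have hflow : IsUnitFlow (graph ω) (Iic 0) (Ioi N) (pathFlow N) := by
      refine ⟨⟨fun i j _ => pathFlow_antisymm N i j, fun i j hij => ?_⟩, ?_, fun j hj => ?_⟩
      · unfold pathFlow
        rw [if_neg, if_neg]
        · rintro ⟨-, -, rfl⟩
          exact hij (hadj j).symm
        · rintro ⟨-, -, rfl⟩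
          exact hij (hadj i)
      · unfold amount
        rw [tsum_eq_single ⟨0, by simp⟩, tsum_eq_single ⟨1, by simp⟩]
        · simp only [pathFlow]
          rw [if_pos (by omega)]
        · rintro ⟨j, hj⟩ hne
          have : j ≠ 1 := fun h => hne (Subtype.ext h)
          simp only [mem_compl_iff, mem_Iic] at hj
          simp only [pathFlow]
          rw [if_neg (by omega), if_neg (by omega)]
        · rintro ⟨i, hi⟩ hne
          have : i ≠ 0 := fun h => hne (Subtype.ext h)
          simp only [mem_Iic] at hi
          refine Eq.trans (tsum_congr fun j => ?_) tsum_zero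
          have hj := j.2
          simp only [mem_compl_iff, mem_Iic] at hj
          simp only [pathFlow]
          rw [if_neg (by omega), if_neg (by omega)]
      · simp only [mem_union, mem_Iic, mem_Ioi] at hj
        unfold netFlow
        rw [tsum_eq_sum (s := {j - 1, j + 1}), Finset.sum_pair (by omega)]
        · unfold pathFlow
          rw [if_neg (by omega), if_pos (by omega), if_pos (by omega)]
          norm_num
        · intro i hi
          simp only [Finset.mem_insert, Finset.mem_singleton] at hi
          unfold pathFlow
          rw [if_neg (by omega), if_neg (by omega)]
    refine (iInf₂_le (pathFlow N) ⟨hflow, fun u v hu hv _ => ?_⟩).trans ?_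
    · unfold energy
      exact mul_le_mul' le_rfl (ENNReal.tsum_comp_le_tsum_of_injective Subtype.val_injective
        fun p : ℤ × ℤ => ENNReal.ofReal (pathFlow N p.1 p.2 ^ 2))
    · simp only [mem_Iic, mem_Ioi] at hu hv
      unfold pathFlow
      rw [if_neg (by omega), if_neg (by omega)]

theorem ae_nearest_neighbour (β : ℝ≥0) :
    ∀ᵐ ω ∂(law β), ∀ e : Pair, e.1.2 = e.1.1 + 1 → ω e = true := by
  rw [ae_all_iff]
  intro e
  by_cases he : e.1.2 = e.1.1 + 1
  · have h1 : law β {ω | ω e = true} = 1 := by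
      rw [law_open, edgeProb, if_pos he]
      simp
    have h2 := (prob_compl_eq_zero_iff (μ := law β)
      (measurableSet_eq_fun (measurable_pi_apply e) measurable_const)).2 h1
    filter_upwards [mem_ae_iff.2 h2] with ω hω _ using hω
  · exact Filter.Eventually.of_forall fun ω h => absurd h he

/-- Let `W` tend to infinity in the Markov bound on the number of incident edges. -/
theorem ae_finite_incident (β : ℝ≥0) (I : Finset ℤ) :
    ∀ᵐ ω ∂(law β), ∃ T : Finset Pair, ∀ e : Pair, ω e = true → (e.1.1 ∈ I ∨ e.1.2 ∈ I) → e ∈ T := by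
  rw [ae_iff]
  refine le_antisymm (le_of_forall_gt fun ε hε => ?_) zero_le
  obtain ⟨η, hη, hηε⟩ : ∃ η : ℝ, 0 < η ∧ ENNReal.ofReal η < ε := by
    obtain ⟨η, hη, hηε⟩ := ENNReal.lt_iff_exists_nnreal_btwn.1 hε
    exact ⟨η, by exact_mod_cast hη, by simpa using hηε⟩
  have hC := edgeConst_pos β
  obtain ⟨W, hW⟩ := exists_nat_gt (I.card * (4 * edgeConst β) / η)
  have hW0 : (0 : ℝ) < W := lt_of_le_of_lt (by positivity) hW
  refine lt_of_le_of_lt (le_trans (measure_mono ?_) ((law_compl_fewEdges_le β le_rfl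
    (subset_refl (incident I 1)) (W := W) (by exact_mod_cast hW0)).trans
      (ENNReal.ofReal_le_ofReal ?_))) hηε
  · rintro ω hω ⟨T, -, hT⟩
    exact hω ⟨T, fun e he hI => hT e ⟨hI, len_pos e⟩ he⟩
  · rw [Int.cast_one, div_one, div_le_iff₀ hW0, mul_comm η]
    exact ((div_lt_iff₀ hη).1 hW).le

/-- Needed because a real `sSup` of an unbounded set is `0`. The nearest-neighbour path bounds
`Rhat` almost surely, and an event of positive probability meets the almost sure one. -/
theorem bddAbove_quantile (β : ℝ≥0) {α : ℝ} (hα : α < 1) (n : ℕ) :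
    BddAbove {r : ℝ | 0 ≤ r ∧
      ENNReal.ofReal (1 - α) ≤ law β {ω | ENNReal.ofReal r ≤ Rhat (graph ω) n}} := by
  obtain ⟨K, hK, hle⟩ := exists_Rhat_le n
  refine ⟨K.toReal, ?_⟩
  rintro r ⟨-, hr⟩
  have hpos : law β {ω | ENNReal.ofReal r ≤ Rhat (graph ω) n} ≠ 0 :=
    ((ENNReal.ofReal_pos.2 (sub_pos.2 hα)).trans_le hr).ne'
  obtain ⟨ω, h1, h2⟩ : ∃ ω, ENNReal.ofReal r ≤ Rhat (graph ω) n ∧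
      ∀ e : Pair, e.1.2 = e.1.1 + 1 → ω e = true := by
    by_contra hcon
    push Not at hcon
    refine hpos (measure_mono_null (fun ω hω => ?_) (ae_iff.1 (ae_nearest_neighbour β)))
    intro h
    obtain ⟨e, he, he'⟩ := hcon ω hω
    exact he' (h e he)
  exact (ENNReal.ofReal_le_iff_le_toReal hK).1 (h1.trans (hle ω h2))

theorem le_quantile {β : ℝ≥0} {α α' r : ℝ} {n : ℕ} (hα : α < 1) (hα'0 : 0 ≤ α') (hα' : α' ≤ α)
    (hr : 0 ≤ r) (h : Robust β α' (2 ^ n) r) : r ≤ quantile β α n := by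
  refine le_csSup (bddAbove_quantile β hα n) ⟨hr, ?_⟩
  obtain ⟨S, hS, hlaw, hcross⟩ := h 0
  have h1 : ENNReal.ofReal (1 - α) ≤ law β S := by
    have h2 := prob_compl_eq_one_sub (μ := law β) hS.measurableSet.compl
    rw [compl_compl] at h2
    rw [h2, ENNReal.ofReal_sub _ (hα'0.trans hα'), ENNReal.ofReal_one]
    exact tsub_le_tsub_left (hlaw.trans (ENNReal.ofReal_le_ofReal hα')) _
  -- Monotonicity of the outer measure suffices: only `S`, not the event on `Rhat`, has to be
  -- measurable.
  refine h1.trans (measure_mono_ae ?_)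
  filter_upwards [ae_finite_incident β (Finset.Ioc 0 (2 ^ n))] with ω hω hωS
  obtain ⟨T, hT⟩ := hω
  have h3 := hcross ω hωS
  rw [zero_add] at h3
  exact ofReal_le_Rhat h3 T fun e he hI => hT e he (by simpa using hI)

end LRP

theorem proposition3p2 (β : ℝ≥0) (hβ : 0 < β) (α : ℝ) (hα₀ : 0 < α) (hα : α ≤ 1 / 2) :
    ∃ c : ℝ, 0 < c ∧ ∃ δ : ℝ, 0 < δ ∧
      ∀ n : ℕ, 1 ≤ n → c * Real.exp (δ * n) ≤ LRP.quantile β α n := by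
  have hα' : 0 < min α (Real.exp (-(64 * β)) / 4) := lt_min hα₀ (by positivity)
  obtain ⟨c, hc, T, hT, h⟩ := LRP.exists_robust_pow β hα' (min_le_right _ _)
  have hT0 : (0 : ℝ) < T := by exact_mod_cast hT
  have hlog := Real.log_pos one_lt_two
  -- The resistance doubles every `T` scales, which gives the rate `log 2 / T`; halving `c` absorbs
  -- the rounding in `n / T`.
  refine ⟨c / 2, by positivity, Real.log 2 / T, by positivity, fun n _ => ?_⟩
  refine le_trans ?_ (LRP.le_quantile (by linarith) hα'.le (min_le_left _ _) (by positivity) (h n))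
  have h1 : (n : ℝ) / T ≤ (n / T : ℕ) + 1 := by
    rw [div_le_iff₀ hT0]
    have h2 : n < (n / T + 1) * T := by
      rw [mul_comm]
      exact Nat.lt_mul_div_succ n hT
    exact_mod_cast h2.le
  have h2 : Real.exp (Real.log 2 / T * n) ≤ 2 ^ (n / T + 1) := by
    have h3 : Real.log 2 / T * n = Real.log 2 * (n / T) := by ring
    rw [h3]
    calc Real.exp (Real.log 2 * (n / T)) ≤ Real.exp (Real.log 2 * ((n / T : ℕ) + 1)) :=
          Real.exp_le_exp.2 (mul_le_mul_of_nonneg_left h1 hlog.le)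
      _ = 2 ^ (n / T + 1) := by
        rw [← Nat.cast_succ, mul_comm, Real.exp_nat_mul, Real.exp_log two_pos]
  calc c / 2 * Real.exp (Real.log 2 / T * n) ≤ c / 2 * 2 ^ (n / T + 1) := by gcongr
    _ = c * 2 ^ (n / T) := by rw [pow_succ]; ring
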